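/- Let $R$ be an associative ring with $1_R\neq 0_R$. All $R$-modules are unital. \textbf{Conventions.} An $R$-ring $\mathcal A$ (with unity) is an $R$-bimodule that is a ring whose multiplication is an $R$-bilinear map $\mathcal A\otimes_R\mathcal A\to\mathcal A$ (so its unity is given by $R\to\mathcal A$, $r\mapsto r1=1r$); morphisms of $R$-rings are $R$-bilinear ring homomorphisms preserving $1$. An $R$-coring $\mathcal C$ is an $R$-bimodule with $R$-bilinear maps $\Delta:\mathcal C\to\mathcal C\otimes_R\mathcal C$, $c\mapsto\sum c_1\otimes c_2$, and $\varepsilon:\mathcal C\to R$ that are coassociative and counital. Its right dual $\mathcal C^*=\mathrm{Hom}_{-R}(\mathcal C,R)$ is an $R$-ring with product $(f\star g)(c)=\sum f(g(c_1)c_2)$, unity $\varepsilon$, and $R$-actions $(rf)(c)=rf(c)$, $(fr)(c)=f(rc)$. A \emph{measuring right $R$-pairing} $P=(\mathcal A,\mathcal C)$ consists of an $R$-ring $\mathcal A$ with unity, an $R$-coring $\mathcal C$ and a morphism of $R$-rings $\kappa_P:\mathcal A\to\mathcal C^*$; write $\langle a,c\rangle=\kappa_P(a)(c)$. In particular $(\mathcal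 C^*,\mathcal C)$, with the identity map, is a measuring right $R$-pairing. $\mathcal C_R$ is \emph{locally projective} if for every surjection $\pi:L\to N$ of right $R$-modules, every $R$-linear $g:\mathcal C\to N$ and every finitely generated submodule $F\subseteq\mathcal C_R$ there is an $R$-linear $g':\mathcal C\to L$ with $\pi g'=g$ on $F$. Density in $\mathcal C^*$ refers to the finite topology, induced from the product topology on $R^{\mathcal C}$ with $R$ discrete. $(\mathcal A,\mathcal C)$ is a \emph{right $\alpha$-pairing} if for every left $R$-module $M$ the map $\alpha_M:\mathcal C\otimes_R M\to\mathrm{Hom}_{R-}(\mathcal A,M)$, $c\otimes m\mapsto[a\mapsto\langle a,c\rangle m]$, is injective; $\mathcal C_R$ \emph{satisfies the $\alpha$-condition} if $(\mathcal C^*,\mathcal C)$ is a right $\alpha$-pairing. A left $\mathcal A$-module $M$ is a left $R$-module with an associative left $R$-linear action $\mathcal A\otimes_RM\to M$; let $\rho_M:M\to\mathrm{Hom}_{R-}(\mathcal A,M)$, $m\mapsto[a\mapsto am]$. It is \emph{unital} if $\mathcal AM=M$ (category ${}_{\mathcal A}\mathcal M$) and \emph{$\mathcal A$-faithful} if $\rho_M$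 is injective (category ${}_{\mathcal A}\widetilde{\mathcal M}$). It is \emph{$\mathcal C$-rational} if $\rho_M(M)\subseteq\alpha_M(\mathcal C\otimes_RM)$; ${}^{\mathcal C}\mathrm{Rat}(-)$ denotes the full subcategory of $\mathcal C$-rational modules. ${}^{\mathcal C}\mathcal M$ is the category of left $\mathcal C$-comodules $(M,\varrho_M:M\to\mathcal C\otimes_RM)$, $\varrho_M(m)=\sum m_{<-1>}\otimes m_{<0>}$, with $\varrho_M$ left $R$-linear, coassociative and injective, and of $\mathcal C$-colinear maps. The \emph{canonical functor} from left $\mathcal C$-comodules to left $\mathcal A$-modules is the identity on underlying $R$-modules and maps, with $am=\sum\langle a,m_{<-1>}\rangle m_{<0>}$. In particular $\mathcal C$ is a left $\mathcal A$-module, and $\sigma[{}_{\mathcal A}\mathcal C]$ is the full subcategory of ${}_{\mathcal A}\mathcal M$ of all modules isomorphic to a submodule of an epimorphic image of a direct sum of copies of $\mathcal C$. All this applies also with $\mathcal C^*$ in place of $\mathcal A$. Below, ${}^{\mathcal C}\mathcal M\simeq\mathcal D$ means that the canonical functor is an isomorphism of categories from ${}^{\mathcal C}\mathcal M$ onto the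 full subcategory $\mathcal D$. \textbf{Theorem.} For a measuring right $R$-pairing $P=(\mathcal A,\mathcal C)$ the following are equivalent: (i) $\mathcal C_R$ is locally projective and $\kappa_P(\mathcal A)\subseteq\mathcal C^*$ is dense; (ii) $\mathcal C_R$ satisfies the $\alpha$-condition and $\kappa_P(\mathcal A)\subseteq\mathcal C^*$ is dense; (iii) $(\mathcal A,\mathcal C)$ is a right $\alpha$-pairing; (iv) $\sigma[{}_{\mathcal C^*}\mathcal C]\simeq{}^{\mathcal C}\mathcal M\simeq\sigma[{}_{\mathcal A}\mathcal C]$. If these equivalent conditions are satisfied, then there are isomorphisms of categories $${}^{\mathcal C}\mathcal M\simeq{}^{\mathcal C}\mathrm{Rat}({}_{\mathcal A}\widetilde{\mathcal M})={}^{\mathcal C}\mathrm{Rat}({}_{\mathcal A}\mathcal M)=\sigma[{}_{\mathcal A}\mathcal C],\qquad {}^{\mathcal C}\mathcal M\simeq{}^{\mathcal C}\mathrm{Rat}({}_{\mathcal C^*}\widetilde{\mathcal M})={}^{\mathcal C}\mathrm{Rat}({}_{\mathcal C^*}\mathcal M)=\sigma[{}_{\mathcal C^*}\mathcal C].$$ 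-/

import Mathlib

open MulOpposite CategoryTheory

universe u

noncomputable section

/-! Left `R`-modules are `Module R`, right `R`-modules are `Module Rᵐᵒᵖ`, so that `op r • m`
is `m r`; an `R`-bimodule carries both, with `SMulCommClass R Rᵐᵒᵖ`. -/

/-! ### The tensor product over a noncommutative ring -/

section Tensor

/-- The relations `m r ⊗ n = m ⊗ r n`. -/
def balancingSubgroup (R M N : Type*) [Ring R] [AddCommGroup M] [Module Rᵐᵒᵖ M]
    [AddCommGroup N] [Module R N] : AddSubgroup (TensorProduct ℤ M N) :=
  AddSubgroup.closure
    {x | ∃ (r : R) (m : M) (n : N),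
      x = TensorProduct.tmul ℤ (op r • m) n - TensorProduct.tmul ℤ m (r • n)}

/-- The abelian group `M ⊗_R N` for a right `R`-module `M` and a left `R`-module `N`. -/
def BalancedTensor (R M N : Type*) [Ring R] [AddCommGroup M] [Module Rᵐᵒᵖ M]
    [AddCommGroup N] [Module R N] : Type _ :=
  TensorProduct ℤ M N ⧸ balancingSubgroup R M N

namespace BalancedTensor

variable {R M N M' N' T : Type*} [Ring R]
  [AddCommGroup M] [Module Rᵐᵒᵖ M] [AddCommGroup N] [Module R N]
  [AddCommGroup M'] [Module Rᵐᵒᵖ M'] [AddCommGroup N'] [Module R N'] [AddCommGroup T]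

instance : AddCommGroup (BalancedTensor R M N) :=
  inferInstanceAs (AddCommGroup (TensorProduct ℤ M N ⧸ balancingSubgroup R M N))

variable (R) in
/-- The elementary tensor `m ⊗ n`. -/
def tmul (m : M) (n : N) : BalancedTensor R M N :=
  QuotientAddGroup.mk' (balancingSubgroup R M N) (TensorProduct.tmul ℤ m n)

theorem tmul_add (m : M) (n n' : N) : tmul R m (n + n') = tmul R m n + tmul R m n' := by
  simp only [tmul, TensorProduct.tmul_add, map_add]
  rfl

theorem add_tmul (m m' : M) (n : N) : tmul R (m + m') n = tmul R m n + tmul R m' n := by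
  simp only [tmul, TensorProduct.add_tmul, map_add]
  rfl

theorem op_smul_tmul (r : R) (m : M) (n : N) : tmul R (op r • m) n = tmul R m (r • n) := by
  have h : TensorProduct.tmul ℤ (op r • m) n - TensorProduct.tmul ℤ m (r • n) ∈
      balancingSubgroup R M N := AddSubgroup.subset_closure ⟨r, m, n, rfl⟩
  have h2 := (QuotientAddGroup.eq_zero_iff (N := balancingSubgroup R M N) _).2 h
  exact sub_eq_zero.1 h2

theorem induction_on {p : BalancedTensor R M N → Prop} (t : BalancedTensor R M N)
    (h0 : p 0) (ht : ∀ m n, p (tmul R m n)) (ha : ∀ x y, p x → p y → p (x + y)) : p t := by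
  obtain ⟨s, rfl⟩ := QuotientAddGroup.mk'_surjective (balancingSubgroup R M N) t
  induction s using TensorProduct.induction_on with
  | zero => exact h0
  | tmul m n => exact ht m n
  | add x y hx hy => exact ha _ _ hx hy

/-- The additive map out of `M ⊗_R N` induced by a biadditive `R`-balanced map. -/
def lift (f : M →+ N →+ T) (hf : ∀ (r : R) (m : M) (n : N), f (op r • m) n = f m (r • n)) :
    BalancedTensor R M N →+ T :=
  QuotientAddGroup.lift (balancingSubgroup R M N)
    (TensorProduct.liftAddHom f (fun z m n => by simp)) (by
      unfold balancingSubgroup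
      rw [AddSubgroup.closure_le]
      rintro x ⟨r, m, n, rfl⟩
      simp [hf])

@[simp]
theorem lift_tmul (f : M →+ N →+ T)
    (hf : ∀ (r : R) (m : M) (n : N), f (op r • m) n = f m (r • n)) (m : M) (n : N) :
    lift f hf (tmul R m n) = f m n := rfl

theorem hom_ext {f g : BalancedTensor R M N →+ T}
    (h : ∀ m n, f (tmul R m n) = g (tmul R m n)) : f = g := by
  ext t
  induction t using induction_on with
  | h0 => simp
  | ht m n => exact h m n
  | ha x y hx hy => simp [hx, hy]

/-- `f ⊗ g` for a right `R`-linear `f` and a left `R`-linear `g`. -/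
def tensorMap (f : M →ₗ[Rᵐᵒᵖ] M') (g : N →ₗ[R] N') :
    BalancedTensor R M N →+ BalancedTensor R M' N' :=
  lift (AddMonoidHom.mk' (fun m => AddMonoidHom.mk' (fun n => tmul R (f m) (g n))
      (fun n n' => by rw [map_add, tmul_add]))
      (fun m m' => by ext n; simp [add_tmul]))
    (fun r m n => by simp [op_smul_tmul])

@[simp]
theorem tensorMap_tmul (f : M →ₗ[Rᵐᵒᵖ] M') (g : N →ₗ[R] N') (m : M) (n : N) :
    tensorMap f g (tmul R m n) = tmul R (f m) (g n) := rfl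

section Left

variable [Module R M] [SMulCommClass R Rᵐᵒᵖ M]

/-- Left multiplication by `r` on `M ⊗_R N` for a bimodule `M`. -/
def leftMul (r : R) : BalancedTensor R M N →+ BalancedTensor R M N :=
  tensorMap
    { toFun := fun m => r • m
      map_add' := smul_add r
      map_smul' := fun s m => smul_comm r s m } LinearMap.id

@[simp]
theorem leftMul_tmul (r : R) (m : M) (n : N) :
    leftMul r (tmul R m n) = tmul R (r • m) n := rfl

/-- The left `R`-module `M ⊗_R N` for a bimodule `M`: `r (m ⊗ n) = (r m) ⊗ n`. -/
instance : Module R (BalancedTensor R M N) where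
  smul r t := leftMul r t
  one_smul t := by
    refine DFunLike.congr_fun (f := leftMul (1 : R)) (g := AddMonoidHom.id _)
      (hom_ext fun m n => ?_) t
    simp
  mul_smul r s t := by
    refine DFunLike.congr_fun (f := leftMul (r * s)) (g := (leftMul r).comp (leftMul s))
      (hom_ext fun m n => ?_) t
    simp [mul_smul]
  smul_zero r := map_zero (leftMul r)
  smul_add r := map_add (leftMul r)
  add_smul r s t := by
    refine DFunLike.congr_fun (f := leftMul (r + s)) (g := leftMul r + leftMul s)
      (hom_ext fun m n => ?_) t
    simp [add_smul, add_tmul]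
  zero_smul t := by
    refine DFunLike.congr_fun (f := leftMul (0 : R)) (g := 0) (hom_ext fun m n => ?_) t
    have := add_tmul (R := R) (0 : M) 0 n
    simpa using this

theorem smul_tmul' (r : R) (m : M) (n : N) : r • tmul R m n = tmul R (r • m) n := rfl

end Left

section Right

variable [Module Rᵐᵒᵖ N] [SMulCommClass R Rᵐᵒᵖ N]

/-- Right multiplication by `r` on `M ⊗_R N` for a bimodule `N`. -/
def rightMul (r : Rᵐᵒᵖ) : BalancedTensor R M N →+ BalancedTensor R M N :=
  tensorMap LinearMap.id
    { toFun := fun n => r • n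
      map_add' := smul_add r
      map_smul' := fun s n => (smul_comm s r n).symm }

@[simp]
theorem rightMul_tmul (r : Rᵐᵒᵖ) (m : M) (n : N) :
    rightMul r (tmul R m n) = tmul R m (r • n) := rfl

/-- The right `R`-module `M ⊗_R N` for a bimodule `N`: `(m ⊗ n) r = m ⊗ (n r)`. -/
instance : Module Rᵐᵒᵖ (BalancedTensor R M N) where
  smul r t := rightMul r t
  one_smul t := by
    refine DFunLike.congr_fun (f := rightMul (1 : Rᵐᵒᵖ)) (g := AddMonoidHom.id _)
      (hom_ext fun m n => ?_) t
    simp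
  mul_smul r s t := by
    refine DFunLike.congr_fun (f := rightMul (r * s)) (g := (rightMul r).comp (rightMul s))
      (hom_ext fun m n => ?_) t
    simp [mul_smul]
  smul_zero r := map_zero (rightMul r)
  smul_add r := map_add (rightMul r)
  add_smul r s t := by
    refine DFunLike.congr_fun (f := rightMul (r + s)) (g := rightMul r + rightMul s)
      (hom_ext fun m n => ?_) t
    simp [add_smul, tmul_add]
  zero_smul t := by
    refine DFunLike.congr_fun (f := rightMul (0 : Rᵐᵒᵖ)) (g := 0) (hom_ext fun m n => ?_) t
    have := tmul_add (R := R) m (0 : N) 0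
    simpa using this

theorem smul_tmul_right (r : Rᵐᵒᵖ) (m : M) (n : N) : r • tmul R m n = tmul R m (r • n) := rfl

end Right

section Assoc

variable {L : Type*} [AddCommGroup L] [Module Rᵐᵒᵖ L] [Module R M] [SMulCommClass R Rᵐᵒᵖ M]

/-- `l ⊗ m ↦ l ⊗ (m ⊗ n)` for a fixed `n`. -/
def assocAux (n : N) : BalancedTensor R L M →+ BalancedTensor R L (BalancedTensor R M N) :=
  lift (AddMonoidHom.mk' (fun l => AddMonoidHom.mk' (fun m => tmul R l (tmul R m n))
      (fun m m' => by rw [add_tmul, tmul_add]))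
      (fun l l' => AddMonoidHom.ext fun m => add_tmul l l' (tmul R m n)))
    (fun r l m => op_smul_tmul r l (tmul R m n))

theorem assocAux_add (n n' : N) :
    (assocAux (n + n') : BalancedTensor R L M →+ BalancedTensor R L (BalancedTensor R M N)) =
      assocAux n + assocAux n' :=
  hom_ext fun l m => (congrArg (tmul R l) (tmul_add m n n')).trans (tmul_add l _ _)

theorem assocAux_op_smul (r : R) (t : BalancedTensor R L M) (n : N) :
    assocAux n (op r • t) = assocAux (r • n) t := by
  induction t using induction_on with
  | h0 => rw [smul_zero, map_zero, map_zero]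
  | ht l m => exact congrArg (tmul R l) (op_smul_tmul r m n)
  | ha x y hx hy => rw [smul_add, map_add, map_add, hx, hy]

/-- The associativity map `(L ⊗_R M) ⊗_R N → L ⊗_R (M ⊗_R N)`, for a bimodule `M`. -/
def assoc (R L M N : Type*) [Ring R] [AddCommGroup L] [Module Rᵐᵒᵖ L] [AddCommGroup M]
    [Module R M] [Module Rᵐᵒᵖ M] [SMulCommClass R Rᵐᵒᵖ M] [AddCommGroup N] [Module R N] :
    BalancedTensor R (BalancedTensor R L M) N →+
    BalancedTensor R L (BalancedTensor R M N) :=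
  lift (AddMonoidHom.mk' (fun t => AddMonoidHom.mk' (fun n => assocAux n t)
      (fun n n' => by rw [assocAux_add, AddMonoidHom.add_apply]))
      (fun t t' => AddMonoidHom.ext fun n => map_add (assocAux n) t t'))
    (fun r t n => assocAux_op_smul r t n)

@[simp]
theorem assoc_tmul (l : L) (m : M) (n : N) :
    assoc R L M N (tmul R (tmul R l m) n) = tmul R l (tmul R m n) := rfl

end Assoc

/-- `m ⊗ n ↦ f(m) n`, that is `f ⊗ id` followed by `R ⊗_R N = N`. -/
def evalLeft (f : M →ₗ[Rᵐᵒᵖ] R) : BalancedTensor R M N →+ N :=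
  lift (AddMonoidHom.mk' (fun m => AddMonoidHom.mk' (fun n => f m • n) (smul_add _))
      (fun m m' => by ext n; simp [add_smul]))
    (fun r m n => by simp [mul_smul])

@[simp]
theorem evalLeft_tmul (f : M →ₗ[Rᵐᵒᵖ] R) (m : M) (n : N) :
    evalLeft f (tmul R m n) = f m • n := rfl

/-- `m ⊗ n ↦ m g(n)`, that is `id ⊗ g` followed by `M ⊗_R R = M`. -/
def evalRight (g : N →ₗ[R] R) : BalancedTensor R M N →+ M :=
  lift (AddMonoidHom.mk' (fun m => AddMonoidHom.mk' (fun n => op (g n) • m)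
        (fun n n' => by simp [add_smul]))
      (fun m m' => by ext n; simp))
    (fun r m n => by simp [mul_smul])

@[simp]
theorem evalRight_tmul (g : N →ₗ[R] R) (m : M) (n : N) :
    evalRight g (tmul R m n) = op (g n) • m := rfl

end BalancedTensor

end Tensor

/-! ### Corings and their right dual rings -/

open BalancedTensor

/-- `W* = Hom_{-R}(W, R)`, the right `R`-linear maps from a right `R`-module `W` to `R`. -/
def RightDual (R W : Type*) [Ring R] [AddCommGroup W] [Module Rᵐᵒᵖ W] : Type _ :=
  W →ₗ[Rᵐᵒᵖ] R

namespace RightDual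

variable {R W : Type*} [Ring R] [AddCommGroup W] [Module Rᵐᵒᵖ W]

instance : AddCommGroup (RightDual R W) := inferInstanceAs (AddCommGroup (W →ₗ[Rᵐᵒᵖ] R))

/-- `(r f)(w) = r f(w)`. -/
instance : Module R (RightDual R W) := inferInstanceAs (Module R (W →ₗ[Rᵐᵒᵖ] R))

/-- The linear map underlying an element of the dual. -/
def toLin (f : RightDual R W) : W →ₗ[Rᵐᵒᵖ] R := f

theorem ext {f g : RightDual R W} (h : ∀ w, f.toLin w = g.toLin w) : f = g :=
  LinearMap.ext h

@[simp]
theorem add_toLin (f g : RightDual R W) (w : W) :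
    (f + g).toLin w = f.toLin w + g.toLin w := rfl

@[simp]
theorem zero_toLin (w : W) : (0 : RightDual R W).toLin w = 0 := rfl

@[simp]
theorem smul_toLin (r : R) (f : RightDual R W) (w : W) :
    (r • f).toLin w = r * f.toLin w := rfl

/-- For a bimodule `W`, the map `w ↦ f(r w)`. -/
def opSMul [Module R W] [SMulCommClass R Rᵐᵒᵖ W] (r : R) (f : RightDual R W) : RightDual R W :=
  ({ toFun := fun w => f.toLin (r • w)
     map_add' := fun w w' => by rw [smul_add, map_add]
     map_smul' := fun s w => by rw [smul_comm r s w, map_smul]; rfl } : W →ₗ[Rᵐᵒᵖ] R)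

/-- For a bimodule `W`: `(f r)(w) = f(r w)`. -/
instance [Module R W] [SMulCommClass R Rᵐᵒᵖ W] : Module Rᵐᵒᵖ (RightDual R W) where
  smul r f := opSMul (unop r) f
  one_smul f := ext fun w => congrArg f.toLin (one_smul R w)
  mul_smul r s f := ext fun w => congrArg f.toLin (mul_smul (unop s) (unop r) w)
  smul_zero _ := ext fun _ => rfl
  smul_add _ _ _ := ext fun _ => rfl
  add_smul r s f := ext fun w =>
    (congrArg f.toLin (add_smul (unop r) (unop s) w)).trans (map_add f.toLin _ _)
  zero_smul f := ext fun w => (congrArg f.toLin (zero_smul R w)).trans (map_zero f.toLin)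

@[simp]
theorem op_smul_toLin [Module R W] [SMulCommClass R Rᵐᵒᵖ W] (r : R) (f : RightDual R W) (w : W) :
    (op r • f).toLin w = f.toLin (r • w) := rfl

/-- The finite topology: induced from the product topology on `R^W`, with `R` discrete. -/
@[reducible] def finiteTopology (R W : Type*) [Ring R] [AddCommGroup W] [Module Rᵐᵒᵖ W] :
    TopologicalSpace (RightDual R W) :=
  TopologicalSpace.induced (fun f w => f.toLin w) (@Pi.topologicalSpace W (fun _ => R) fun _ => ⊥)

end RightDual

/-- A coassociative counital `R`-coring structure on an `R`-bimodule `C`. -/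
class Coring (R C : Type*) [Ring R] [AddCommGroup C] [Module R C] [Module Rᵐᵒᵖ C]
    [SMulCommClass R Rᵐᵒᵖ C] where
  /-- the comultiplication, left `R`-linear -/
  comul : C →ₗ[R] BalancedTensor R C C
  comul_op_smul (r : R) (c : C) : comul (op r • c) = op r • comul c
  /-- the counit, left `R`-linear -/
  counit : C →ₗ[R] R
  counit_op_smul (r : R) (c : C) : counit (op r • c) = counit c * r
  coassoc (c : C) :
    tensorMap LinearMap.id comul (comul c) =
      assoc R C C C
        (tensorMap
          { toFun := comul
            map_add' := map_add comul
            map_smul' := fun r => comul_op_smul (unop r) } LinearMap.id (comul c))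
  counit_comul (c : C) :
    evalLeft
      { toFun := counit
        map_add' := map_add counit
        map_smul' := fun r => counit_op_smul (unop r) } (comul c) = c
  comul_counit (c : C) : evalRight counit (comul c) = c

namespace Coring

variable (R C : Type*) [Ring R] [AddCommGroup C] [Module R C] [Module Rᵐᵒᵖ C]
  [SMulCommClass R Rᵐᵒᵖ C] [Coring R C]

/-- The comultiplication as a right `R`-linear map. -/
def comulRight : C →ₗ[Rᵐᵒᵖ] BalancedTensor R C C where
  toFun := comul (R := R)
  map_add' := map_add _
  map_smul' r := comul_op_smul (unop r)

/-- The counit as an element of `C*`. -/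
def counitDual : RightDual R C :=
  ({ toFun := counit (R := R)
     map_add' := map_add _
     map_smul' := fun r => counit_op_smul (unop r) } : C →ₗ[Rᵐᵒᵖ] R)

end Coring

/-- A counital left `C`-comodule: a left `R`-module `M` with a left `R`-linear coassociative
coaction `M → C ⊗_R M`, counital meaning that the coaction is injective. -/
structure LeftComodule (R C : Type u) [Ring R] [AddCommGroup C] [Module R C] [Module Rᵐᵒᵖ C]
    [SMulCommClass R Rᵐᵒᵖ C] [Coring R C] where
  carrier : Type u
  [addCommGroup : AddCommGroup carrier]
  [module : Module R carrier]
  coact : carrier →ₗ[R] BalancedTensor R C carrier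
  coassoc (m : carrier) :
    tensorMap LinearMap.id coact (coact m) =
      assoc R C C carrier (tensorMap (Coring.comulRight R C) LinearMap.id (coact m))
  counital : Function.Injective coact

attribute [instance] LeftComodule.addCommGroup LeftComodule.module

namespace LeftComodule

variable {R C : Type u} [Ring R] [AddCommGroup C] [Module R C] [Module Rᵐᵒᵖ C]
  [SMulCommClass R Rᵐᵒᵖ C] [Coring R C]

/-- `C`-colinear maps. -/
@[ext]
structure Hom (M N : LeftComodule R C) where
  toLin : M.carrier →ₗ[R] N.carrier
  colinear (m : M.carrier) : N.coact (toLin m) = tensorMap LinearMap.id toLin (M.coact m)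

/-- The category `^C M` of counital left `C`-comodules and `C`-colinear maps. -/
instance : Category (LeftComodule R C) where
  Hom := Hom
  id M := ⟨LinearMap.id, fun m =>
    (DFunLike.congr_fun (f := tensorMap LinearMap.id LinearMap.id) (g := AddMonoidHom.id _)
      (hom_ext fun _ _ => rfl) (M.coact m)).symm⟩
  comp {M N L} f g := ⟨g.toLin.comp f.toLin, fun m => by
    rw [LinearMap.comp_apply, g.colinear, f.colinear]
    exact DFunLike.congr_fun
      (f := (tensorMap LinearMap.id g.toLin).comp (tensorMap LinearMap.id f.toLin))
      (g := tensorMap LinearMap.id (g.toLin.comp f.toLin))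
      (hom_ext fun _ _ => rfl) (M.coact m)⟩

variable (R C) in
/-- `C` as a left comodule over itself. -/
def self : LeftComodule R C where
  carrier := C
  coact := Coring.comul
  coassoc := Coring.coassoc
  counital := Function.LeftInverse.injective
    (g := evalLeft (Coring.counitDual R C).toLin) Coring.counit_comul

/-- `(f ⋆ g) · m = f · (g · m)` where `f · m = ∑ f(m₋₁) m₀`. -/
theorem evalLeft_coact (M : LeftComodule R C) (f g fg : C →ₗ[Rᵐᵒᵖ] R)
    (h : ∀ c, fg c = f (evalLeft g (Coring.comul (R := R) c))) (m : M.carrier) :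
    evalLeft fg (M.coact m) = evalLeft f (M.coact (evalLeft g (M.coact m))) := by
  have h1 : ∀ t : BalancedTensor R C M.carrier,
      M.coact (evalLeft g t) = evalLeft g (tensorMap LinearMap.id M.coact t) := fun t => by
    induction t using induction_on with
    | h0 => simp
    | ht c m => simp
    | ha x y hx hy => simp [hx, hy]
  have h2 : ∀ (s : BalancedTensor R C C) (m : M.carrier),
      f (evalLeft g s) • m = evalLeft f (evalLeft g (assoc R C C M.carrier (tmul R s m))) :=
    fun s m => by
      induction s using induction_on with
      | h0 =>
        have h0 : tmul R (0 : BalancedTensor R C C) m = 0 := by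
          simpa using add_tmul (R := R) (0 : BalancedTensor R C C) 0 m
        simp [h0]
      | ht c d => simp [smul_tmul']
      | ha x y hx hy => simp [add_tmul, add_smul, hx, hy]
  have h3 : ∀ t : BalancedTensor R C M.carrier,
      evalLeft fg t = evalLeft f (evalLeft g
        (assoc R C C M.carrier (tensorMap (Coring.comulRight R C) LinearMap.id t))) := fun t => by
    induction t using induction_on with
    | h0 => simp
    | ht c m =>
      rw [tensorMap_tmul, LinearMap.id_apply, ← h2, evalLeft_tmul, h]
      rfl
    | ha x y hx hy => simp [hx, hy]
  rw [h1, M.coassoc, h3]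

end LeftComodule

namespace RightDual

variable {R C : Type u} [Ring R] [AddCommGroup C] [Module R C] [Module Rᵐᵒᵖ C]
  [SMulCommClass R Rᵐᵒᵖ C] [Coring R C]

/-- The product of `C*`: `(f ⋆ g)(c) = ∑ f(g(c₁) c₂)`. -/
def star (f g : RightDual R C) : RightDual R C :=
  ({ toFun := fun c => f.toLin (evalLeft g.toLin (Coring.comul (R := R) c))
     map_add' := fun c d => by simp
     map_smul' := fun r c => by
      have h : ∀ t : BalancedTensor R C C,
          evalLeft g.toLin (r • t) = r • evalLeft g.toLin t := fun t => by
        induction t using induction_on with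
        | h0 => simp
        | ht c d => simp [smul_tmul_right, smul_comm]
        | ha x y hx hy => simp [hx, hy]
      have h2 : Coring.comul (R := R) (r • c) = r • Coring.comul (R := R) c :=
        Coring.comul_op_smul (unop r) c
      rw [h2, h, map_smul]
      rfl } : C →ₗ[Rᵐᵒᵖ] R)

theorem star_toLin (f g : RightDual R C) (c : C) :
    (star f g).toLin c = f.toLin (evalLeft g.toLin (Coring.comul (R := R) c)) := rfl

/-- The ring `(C*, ⋆)`, with unit the counit. -/
instance : Ring (RightDual R C) where
  __ := (inferInstance : AddCommGroup (RightDual R C))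
  mul := star
  one := Coring.counitDual R C
  mul_assoc f g h := ext fun c =>
    congrArg f.toLin (LeftComodule.evalLeft_coact (LeftComodule.self R C) g.toLin h.toLin
      (star g h).toLin (fun _ => rfl) (show (LeftComodule.self R C).carrier from c)).symm
  one_mul f := ext fun c => by
    have h : ∀ t : BalancedTensor R C C, (Coring.counitDual R C).toLin (evalLeft f.toLin t) =
        f.toLin (evalRight (Coring.counit (R := R)) t) := fun t => by
      induction t using induction_on with
      | h0 => simp
      | ht c d =>
        exact (map_smul (Coring.counit (R := R)) (f.toLin c) d).trans
          (map_smul f.toLin (op (Coring.counit (R := R) d)) c).symm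
      | ha x y hx hy => simp [hx, hy]
    exact (h _).trans (congrArg f.toLin (Coring.comul_counit c))
  mul_one f := ext fun c => congrArg f.toLin (Coring.counit_comul c)
  left_distrib f g h := ext fun c => by
    have h1 : ∀ t : BalancedTensor R C C, evalLeft (g + h).toLin t =
        evalLeft g.toLin t + evalLeft h.toLin t := fun t => by
      induction t using induction_on with
      | h0 => simp
      | ht c d => simp [add_smul]
      | ha x y hx hy => rw [map_add, map_add, map_add, hx, hy]; abel
    exact (congrArg f.toLin (h1 _)).trans (map_add f.toLin _ _)
  right_distrib f g h := ext fun c => rfl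
  zero_mul f := ext fun c => rfl
  mul_zero f := ext fun c => by
    have h1 : ∀ t : BalancedTensor R C C, evalLeft (0 : RightDual R C).toLin t = (0 : C) :=
      fun t => by
        induction t using induction_on with
        | h0 => simp
        | ht c d => simp
        | ha x y hx hy => rw [map_add, hx, hy, add_zero]
    exact (congrArg f.toLin (h1 _)).trans (map_zero f.toLin)

theorem mul_toLin (f g : RightDual R C) (c : C) :
    (f * g).toLin c = f.toLin (evalLeft g.toLin (Coring.comul (R := R) c)) := rfl

end RightDual

/-! ### Rings over `R` and their modules -/

/-- `A` is an associative `R`-ring with unity: an `R`-bimodule and a ring whose multiplication is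
an `R`-bilinear map `A ⊗_R A → A`. The unity map `R → A` is `r ↦ r 1 = 1 r`. -/
class RRing (R A : Type*) [Ring R] [Ring A] [Module R A] [Module Rᵐᵒᵖ A] : Prop where
  smul_op_smul (r s : R) (a : A) : r • op s • a = op s • r • a
  smul_mul (r : R) (a b : A) : (r • a) * b = r • (a * b)
  mul_op_smul (r : R) (a b : A) : a * (op r • b) = op r • (a * b)
  op_smul_mul (r : R) (a b : A) : (op r • a) * b = a * (r • b)

instance {R C : Type u} [Ring R] [AddCommGroup C] [Module R C] [Module Rᵐᵒᵖ C]
    [SMulCommClass R Rᵐᵒᵖ C] [Coring R C] : RRing R (RightDual R C) where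
  smul_op_smul r s a := rfl
  smul_mul r a b := rfl
  mul_op_smul r a b := RightDual.ext fun c => by
    have h : ∀ t : BalancedTensor R C C,
        evalLeft (op r • b).toLin t = evalLeft b.toLin (r • t) := fun t => by
      induction t using induction_on with
      | h0 => simp
      | ht c d => simp [smul_tmul']
      | ha x y hx hy => rw [map_add, smul_add, map_add, hx, hy]
    rw [RightDual.mul_toLin, RightDual.op_smul_toLin, RightDual.mul_toLin, h,
      ← LinearMap.map_smul]
  op_smul_mul r a b := RightDual.ext fun c => by
    have h : ∀ t : BalancedTensor R C C,
        evalLeft (r • b).toLin t = r • evalLeft b.toLin t := fun t => by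
      induction t using induction_on with
      | h0 => simp
      | ht c d => simp [mul_smul]
      | ha x y hx hy => rw [map_add, map_add, smul_add, hx, hy]
    rw [RightDual.mul_toLin, RightDual.op_smul_toLin, RightDual.mul_toLin, h]

/-- A left module over the `R`-ring `A`, not required to be unital over `A`: a left `R`-module with
an associative action `A ⊗_R M → M`. -/
structure LeftRingModule (R A : Type u) [Ring R] [Ring A] [Module R A] [Module Rᵐᵒᵖ A] where
  carrier : Type u
  [addCommGroup : AddCommGroup carrier]
  [module : Module R carrier]
  act : A →+ carrier →+ carrier
  smul_act (r : R) (a : A) (m : carrier) : act (r • a) m = r • act a m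
  op_smul_act (r : R) (a : A) (m : carrier) : act (op r • a) m = act a (r • m)
  mul_act (a b : A) (m : carrier) : act (a * b) m = act a (act b m)

attribute [instance] LeftRingModule.addCommGroup LeftRingModule.module

namespace LeftRingModule

variable {R A : Type u} [Ring R] [Ring A] [Module R A] [Module Rᵐᵒᵖ A]

/-- `A`-linear maps. -/
@[ext]
structure Hom (M N : LeftRingModule R A) where
  toLin : M.carrier →ₗ[R] N.carrier
  map_act (a : A) (m : M.carrier) : toLin (M.act a m) = N.act a (toLin m)

/-- The category of all (not necessarily unital) left `A`-modules and `A`-linear maps. -/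
instance : Category (LeftRingModule R A) where
  Hom := Hom
  id M := ⟨LinearMap.id, fun _ _ => rfl⟩
  comp f g := ⟨g.toLin.comp f.toLin, fun a m => by
    rw [LinearMap.comp_apply, f.map_act, g.map_act, LinearMap.comp_apply]⟩

/-- The canonical map `ρ_M : M → Hom_{R-}(A, M)`, `m ↦ [a ↦ a m]`. -/
def rho (M : LeftRingModule R A) (m : M.carrier) : A →ₗ[R] M.carrier where
  toFun a := M.act a m
  map_add' a b := by simp
  map_smul' r a := M.smul_act r a m

/-- The unital modules, `A M = M`; the full subcategory of these is `_A M`. -/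
def unital : ObjectProperty (LeftRingModule R A) := fun M =>
  AddSubgroup.closure {x : M.carrier | ∃ (a : A) (m : M.carrier), x = M.act a m} = ⊤

/-- The `A`-faithful modules: `ρ_M` is injective. -/
def faithful : ObjectProperty (LeftRingModule R A) := fun M => Function.Injective M.rho

/-- The direct sum `K^(Λ)`. -/
def directSum (K : LeftRingModule R A) (Λ : Type u) : LeftRingModule R A where
  carrier := Λ →₀ K.carrier
  act := AddMonoidHom.mk' (fun a => Finsupp.mapRange.addMonoidHom (K.act a))
    (fun a b => by ext; simp)
  smul_act r a m := by ext; simp [K.smul_act]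
  op_smul_act r a m := by ext; simp [K.op_smul_act]
  mul_act a b m := by ext; simp [K.mul_act]

/-- `L` is `K`-generated: an epimorphic image of a direct sum of copies of `K`. -/
def IsGenerated (K L : LeftRingModule R A) : Prop :=
  ∃ (Λ : Type u) (p : Hom (K.directSum Λ) L), Function.Surjective p.toLin

/-- `N` is `K`-subgenerated: isomorphic to a submodule of a `K`-generated module. -/
def IsSubgenerated (K N : LeftRingModule R A) : Prop :=
  ∃ L : LeftRingModule R A, IsGenerated K L ∧ ∃ i : Hom N L, Function.Injective i.toLin

/-- The objects of `σ[_A K]`, the full subcategory of the `K`-subgenerated modules in `_A M`. -/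
def sigma (K : LeftRingModule R A) : ObjectProperty (LeftRingModule R A) := fun N =>
  unital N ∧ IsSubgenerated K N

end LeftRingModule

/-! ### Pairings, the α-condition, local projectivity -/

/-- The map `α_M : W ⊗_R M → Hom_{R-}(V, M)`, `w ⊗ m ↦ [v ↦ ⟨v, w⟩ m]`, of the right `R`-pairing
`(V, W)` given by the left `R`-linear map `κ : V → W*`. -/
def alphaMap {R V W : Type*} [Ring R] [AddCommGroup V] [Module R V] [AddCommGroup W]
    [Module Rᵐᵒᵖ W] (κ : V →ₗ[R] RightDual R W) (M : Type*) [AddCommGroup M] [Module R M] :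
    BalancedTensor R W M →+ (V →ₗ[R] M) :=
  lift (AddMonoidHom.mk' (fun w => AddMonoidHom.mk' (fun m =>
        { toFun := fun v => (κ v).toLin w • m
          map_add' := fun v v' => by simp [add_smul]
          map_smul' := fun r v => by simp [mul_smul] })
        (fun m m' => by ext v; simp))
      (fun w w' => by ext m v; simp [add_smul]))
    (fun r w m => by ext v; simp [mul_smul])

/-- The right `R`-pairing `(V, W)` given by `κ` satisfies the right α-condition: `α_M` is injective
for every left `R`-module `M`. -/
def IsRightAlphaPairing {R V W : Type u} [Ring R] [AddCommGroup V] [Module R V] [AddCommGroup W]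
    [Module Rᵐᵒᵖ W] (κ : V →ₗ[R] RightDual R W) : Prop :=
  ∀ (M : Type u) [AddCommGroup M] [Module R M], Function.Injective (alphaMap κ M)

/-- The right `R`-module `W` satisfies the α-condition: the right pairing `(W*, W)` does. -/
def SatisfiesRightAlpha (R W : Type u) [Ring R] [AddCommGroup W] [Module Rᵐᵒᵖ W] : Prop :=
  IsRightAlphaPairing (LinearMap.id : RightDual R W →ₗ[R] RightDual R W)

/-- Local projectivity: for every epimorphism `π : L → N`, every `g : W → N` and every finitely
generated `F ⊆ W` there is `g' : W → L` with `π ∘ g' = g` on `F`. -/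
def IsLocallyProjective (S W : Type u) [Ring S] [AddCommGroup W] [Module S W] : Prop :=
  ∀ (L N : Type u) [AddCommGroup L] [Module S L] [AddCommGroup N] [Module S N]
    (π : L →ₗ[S] N) (g : W →ₗ[S] N) (F : Submodule S W),
    Function.Surjective π → F.FG → ∃ g' : W →ₗ[S] L, ∀ x ∈ F, π (g' x) = g x

/-- The right `R`-pairing `(V, W)` given by `κ` is dense: `κ(V) ⊆ W*` is dense in the finite
topology. -/
def IsDensePairing {R V W : Type*} [Ring R] [AddCommGroup V] [Module R V] [AddCommGroup W]
    [Module Rᵐᵒᵖ W] (κ : V →ₗ[R] RightDual R W) : Prop :=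
  @Dense _ (RightDual.finiteTopology R W) (Set.range κ)

/-- A measuring right `R`-pairing `(A, C)`: a morphism `κ : A → C*` of `R`-rings. -/
structure MeasuringRightPairing (R A C : Type u) [Ring R] [Ring A] [Module R A] [Module Rᵐᵒᵖ A]
    [AddCommGroup C] [Module R C] [Module Rᵐᵒᵖ C] [SMulCommClass R Rᵐᵒᵖ C] [Coring R C] where
  ringHom : A →+* RightDual R C
  map_smul (r : R) (a : A) : ringHom (r • a) = r • ringHom a
  map_op_smul (r : R) (a : A) : ringHom (op r • a) = op r • ringHom a

namespace MeasuringRightPairing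

variable {R A C : Type u} [Ring R] [Ring A] [Module R A] [Module Rᵐᵒᵖ A]
  [AddCommGroup C] [Module R C] [Module Rᵐᵒᵖ C] [SMulCommClass R Rᵐᵒᵖ C] [Coring R C]

variable (R C) in
/-- The measuring right pairing `(C*, C)`. -/
def dual : MeasuringRightPairing R (RightDual R C) C :=
  ⟨RingHom.id _, fun _ _ => rfl, fun _ _ => rfl⟩

/-- The underlying right `R`-pairing. -/
def kappa (P : MeasuringRightPairing R A C) : A →ₗ[R] RightDual R C where
  toFun := P.ringHom
  map_add' := map_add _
  map_smul' := P.map_smul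

/-- The canonical functor from left `C`-comodules to left `A`-modules, the identity on underlying
`R`-modules and on maps: `a m = α_M(ρ(m))(a) = ∑ ⟨a, m₋₁⟩ m₀`. -/
def functor (P : MeasuringRightPairing R A C) : LeftComodule R C ⥤ LeftRingModule R A where
  obj M :=
    { carrier := M.carrier
      act := AddMonoidHom.mk' (fun a => AddMonoidHom.mk'
          (fun m => alphaMap P.kappa M.carrier (M.coact m) a) (fun m m' => by simp))
        (fun a b => by ext m; simp)
      smul_act := fun r a m => LinearMap.map_smul _ r a
      op_smul_act := fun r a m => by
        have h : ∀ t : BalancedTensor R C M.carrier, alphaMap P.kappa M.carrier t (op r • a) =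
            alphaMap P.kappa M.carrier (r • t) a := fun t => by
          induction t using induction_on with
          | h0 => simp
          | ht c m =>
            change (P.ringHom (op r • a)).toLin c • m = (P.ringHom a).toLin (r • c) • m
            rw [P.map_op_smul, RightDual.op_smul_toLin]
          | ha x y hx hy => rw [smul_add, map_add, map_add, LinearMap.add_apply,
              LinearMap.add_apply, hx, hy]
        exact (h _).trans (congrArg (fun t => alphaMap P.kappa M.carrier t a)
          (LinearMap.map_smul M.coact r m).symm)
      mul_act := fun a b m => by
        have h : ∀ (t : BalancedTensor R C M.carrier) (a : A),
            alphaMap P.kappa M.carrier t a = evalLeft (P.ringHom a).toLin t := fun t a => by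
          induction t using induction_on with
          | h0 => simp
          | ht c m => rfl
          | ha x y hx hy => rw [map_add, map_add, LinearMap.add_apply, hx, hy]
        change alphaMap P.kappa M.carrier (M.coact m) (a * b) = alphaMap P.kappa M.carrier
          (M.coact (alphaMap P.kappa M.carrier (M.coact m) b)) a
        rw [h, h, h]
        exact M.evalLeft_coact _ _ _ (fun c => by rw [map_mul]; rfl) m }
  map {M N} f := ⟨f.toLin, fun a m => by
    have h : ∀ t : BalancedTensor R C M.carrier, f.toLin (alphaMap P.kappa M.carrier t a) =
        alphaMap P.kappa N.carrier (tensorMap LinearMap.id f.toLin t) a := fun t => by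
      induction t using induction_on with
      | h0 => simp
      | ht c m => exact _root_.map_smul f.toLin _ _
      | ha x y hx hy => simp only [map_add, LinearMap.add_apply, hx, hy]
    change f.toLin (alphaMap P.kappa M.carrier (M.coact m) a) =
      alphaMap P.kappa N.carrier (N.coact (f.toLin m)) a
    rw [f.colinear, h]⟩

/-- `C` as a left `A`-module, `a ⇀ c = ∑ ⟨a, c₁⟩ c₂`. -/
def selfModule (P : MeasuringRightPairing R A C) : LeftRingModule R A :=
  P.functor.obj (LeftComodule.self R C)

/-- `M` is `C`-rational: `ρ_M(m)` lies in the image of `α_M : C ⊗_R M → Hom_{R-}(A, M)` for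
every `m` in `M`. -/
def IsRational (P : MeasuringRightPairing R A C) (M : LeftRingModule R A) : Prop :=
  ∀ m : M.carrier, M.rho m ∈ Set.range (alphaMap P.kappa M.carrier)

/-- The objects of `^C Rat` of the `A`-faithful modules. -/
def ratFaithful (P : MeasuringRightPairing R A C) : ObjectProperty (LeftRingModule R A) :=
  fun M => LeftRingModule.faithful M ∧ P.IsRational M

/-- The objects of `^C Rat` of the unital modules. -/
def ratUnital (P : MeasuringRightPairing R A C) : ObjectProperty (LeftRingModule R A) :=
  fun M => LeftRingModule.unital M ∧ P.IsRational M

end MeasuringRightPairing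

/-- `F` is an isomorphism of categories from `𝒞` onto the full subcategory of `𝒟` with objects `Q`:
bijective on morphisms, injective on objects, with the objects satisfying `Q` as its values. -/
def IsIsomorphismOnto {𝒞 𝒟 : Type*} [Category 𝒞] [Category 𝒟] (F : 𝒞 ⥤ 𝒟)
    (Q : ObjectProperty 𝒟) : Prop :=
  F.Full ∧ F.Faithful ∧ Function.Injective F.obj ∧ ∀ N : 𝒟, Q N ↔ ∃ M : 𝒞, F.obj M = N

end

/-! The α-condition makes a tensor recoverable from the values it takes when paired with `A`. For a
finite set `S ⊆ C`, let `K ⊆ R^S` be the submodule of all vectors `(⟨a, w⟩)_w`. The map `α` kills `∑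
w ⊗ e_w` in `C ⊗ R^S/K`, so for an α-pairing this sum is zero
(`IsRightAlphaPairing.sum_tmul_eq_zero`). Applying `f ⊗ id` puts `(f(w))_w` in `K`, which is
density. For the pairing with `C*`, a suitable map out of this tensor product gives local
projectivity. Conversely, a tensor involves finitely many elements of `C`. There a dense image
agrees with `C*`, and a locally projective `C` lifts to a free module whose coordinates are
functionals.

Over an α-pairing, `ρ_M(m) = α_M(t)` has at most one solution `t`. Hence faithful rational modules
carry exactly one compatible coaction, and `A`-linear maps between comodules are colinear
(`isIsomorphismOnto_ratFaithful`). Rational modules coincide with `σ[C]`: comodules embed in `C ⊗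
M`, a quotient of `C^(M)`, while rationality passes to `C`-generated modules and to their submodules
(`ratUnital_eq_sigma`).

For (iv) ⇒ (iii), the kernel of `α_M` is an `A`-submodule of the cofree comodule `C ⊗ M`, so it lies
in `σ[C]` and its inclusion is colinear. A colinear map into `C ⊗ M` is determined by its composite
with `ε ⊗ id`. That composite is `α_M` evaluated at `1`, which is zero on the kernel, so the kernel
vanishes. -/

noncomputable section

open BalancedTensor

/-! ### Balanced tensor products: finite support and right exactness. -/

namespace BalancedTensor

variable {R M N M' N' : Type*} [Ring R]
  [AddCommGroup M] [Module Rᵐᵒᵖ M] [AddCommGroup N] [Module R N]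
  [AddCommGroup M'] [Module Rᵐᵒᵖ M'] [AddCommGroup N'] [Module R N']

theorem zero_tmul (n : N) : tmul R (0 : M) n = 0 := by
  simpa using add_tmul (R := R) (0 : M) 0 n

theorem tmul_zero (m : M) : tmul R m (0 : N) = 0 := by
  simpa using tmul_add (R := R) m (0 : N) 0

theorem evalLeft_eq_tensorMap (f : M →ₗ[Rᵐᵒᵖ] R) (t : BalancedTensor R M N) :
    evalLeft f t = evalLeft LinearMap.id (tensorMap f (LinearMap.id : N →ₗ[R] N) t) := by
  induction t using induction_on with
  | h0 => simp only [map_zero]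
  | ht m n => rfl
  | ha x y hx hy => simp only [map_add, hx, hy]

theorem evalLeft_tensorMap_id (f : M →ₗ[Rᵐᵒᵖ] R) (g : N →ₗ[R] N')
    (t : BalancedTensor R M N) :
    evalLeft f (tensorMap LinearMap.id g t) = g (evalLeft f t) :=
  DFunLike.congr_fun (f := (evalLeft f).comp (tensorMap LinearMap.id g))
    (g := g.toAddMonoidHom.comp (evalLeft f))
    (hom_ext fun m n => (map_smul g (f m) n).symm) t

theorem tensorMap_tensorMap_eq_zero {L : Type*} [AddCommGroup L] [Module R L] (j : N →ₗ[R] N')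
    (k : N' →ₗ[R] L) (h : ∀ n, k (j n) = 0) (t : BalancedTensor R M N) :
    tensorMap LinearMap.id k (tensorMap (LinearMap.id : M →ₗ[Rᵐᵒᵖ] M) j t) = 0 := by
  induction t using induction_on with
  | h0 => simp only [map_zero]
  | ht m n => exact (congrArg (tmul R m) (h n)).trans (tmul_zero m)
  | ha x y hx hy => simp only [map_add, hx, hy, add_zero]

theorem tensorMap_id_id (t : BalancedTensor R M N) :
    tensorMap (LinearMap.id : M →ₗ[Rᵐᵒᵖ] M) (LinearMap.id : N →ₗ[R] N) t = t := by
  induction t using induction_on with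
  | h0 => simp only [map_zero]
  | ht m n => rfl
  | ha x y hx hy => simp only [map_add, hx, hy]

theorem evalLeft_assoc [Module R M] [SMulCommClass R Rᵐᵒᵖ M] (f : M' →ₗ[Rᵐᵒᵖ] R)
    (s : BalancedTensor R M' M) (n : N) :
    evalLeft f (assoc R M' M N (tmul R s n)) = tmul R (evalLeft f s) n := by
  induction s using induction_on with
  | h0 => simp only [zero_tmul, map_zero]
  | ht c m => rfl
  | ha x y hx hy => simp only [add_tmul, map_add, hx, hy]

/-- An element of `M ⊗ N` involves only finitely many elements of `M`. -/
theorem exists_finset_tensorMap_congr (M' : Type*) [AddCommGroup M'] [Module Rᵐᵒᵖ M']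
    (t : BalancedTensor R M N) :
    ∃ S : Finset M, ∀ f g : M →ₗ[Rᵐᵒᵖ] M', (∀ x ∈ S, f x = g x) →
      tensorMap f (LinearMap.id : N →ₗ[R] N) t = tensorMap g LinearMap.id t := by
  classical
  induction t using induction_on with
  | h0 => exact ⟨∅, fun f g _ => by simp⟩
  | ht m n => exact ⟨{m}, fun f g h => by simp [h m (by simp)]⟩
  | ha x y hx hy =>
    obtain ⟨S, hS⟩ := hx
    obtain ⟨T, hT⟩ := hy
    refine ⟨S ∪ T, fun f g h => ?_⟩
    rw [map_add, map_add, hS f g fun z hz => h z (Finset.mem_union_left _ hz),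
      hT f g fun z hz => h z (Finset.mem_union_right _ hz)]

/-- Right exactness: an element killed by `M ⊗ N → M ⊗ (N / K)` comes from `M ⊗ K`. -/
theorem mem_range_of_tensorMap_mkQ_eq_zero (i : N' →ₗ[R] N) (t : BalancedTensor R M N)
    (h : tensorMap (LinearMap.id : M →ₗ[Rᵐᵒᵖ] M) (LinearMap.range i).mkQ t = 0) :
    ∃ s, tensorMap LinearMap.id i s = t := by
  set S := (tensorMap (LinearMap.id : M →ₗ[Rᵐᵒᵖ] M) i).range
  -- The assignment `m ⊗ [n] ↦ [m ⊗ n]` into the cokernel of `M ⊗ N' → M ⊗ N` is well defined. It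
  -- sends the image of `t` to the class of `t`, which therefore vanishes.
  let φ (m : M) : (N ⧸ LinearMap.range i) →+ BalancedTensor R M N ⧸ S :=
    QuotientAddGroup.lift _
      (AddMonoidHom.mk' (fun n => QuotientAddGroup.mk' S (tmul R m n))
        (fun n n' => by rw [tmul_add, map_add]))
      (by
        rintro _ ⟨n, rfl⟩
        exact (QuotientAddGroup.eq_zero_iff _).2 ⟨tmul R m n, rfl⟩)
  have hφ (m : M) (n : N) : φ m ((LinearMap.range i).mkQ n) =
      QuotientAddGroup.mk' S (tmul R m n) := rfl
  let ψ : BalancedTensor R M (N ⧸ LinearMap.range i) →+ BalancedTensor R M N ⧸ S :=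
    lift (AddMonoidHom.mk' φ (fun m m' => by
        ext x
        obtain ⟨n, rfl⟩ := Submodule.mkQ_surjective _ x
        rw [AddMonoidHom.add_apply, hφ, hφ, hφ, add_tmul, map_add]))
      (fun r m x => by
        obtain ⟨n, rfl⟩ := Submodule.mkQ_surjective _ x
        change φ (op r • m) _ = φ m _
        rw [← map_smul, hφ, hφ, op_smul_tmul])
  have hψ : ψ (tensorMap LinearMap.id (LinearMap.range i).mkQ t) = QuotientAddGroup.mk' S t :=
    DFunLike.congr_fun (f := ψ.comp (tensorMap LinearMap.id (LinearMap.range i).mkQ))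
      (g := QuotientAddGroup.mk' S) (hom_ext fun _ _ => rfl) t
  rw [h, map_zero] at hψ
  exact (QuotientAddGroup.eq_zero_iff t).1 hψ.symm

variable (R M N) in
/-- The map `M^(N) → M ⊗_R N` that sends `m` in the component of `n` to `m ⊗ n`. -/
def ofFinsupp [Module R M] [SMulCommClass R Rᵐᵒᵖ M] : (N →₀ M) →ₗ[R] BalancedTensor R M N :=
  Finsupp.lsum ℕ fun n =>
    { toFun := fun m => tmul R m n
      map_add' := fun m m' => add_tmul m m' n
      map_smul' := fun _ _ => rfl }

theorem ofFinsupp_single [Module R M] [SMulCommClass R Rᵐᵒᵖ M] (m : M) (n : N) :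
    ofFinsupp R M N (Finsupp.single n m) = tmul R m n := by
  simp only [ofFinsupp, Finsupp.lsum_single]
  rfl

theorem ofFinsupp_surjective [Module R M] [SMulCommClass R Rᵐᵒᵖ M] :
    Function.Surjective (ofFinsupp R M N) := by
  intro t
  induction t using induction_on with
  | h0 => exact ⟨0, map_zero _⟩
  | ht m n => exact ⟨_, ofFinsupp_single m n⟩
  | ha x y hx hy =>
    obtain ⟨x, rfl⟩ := hx
    obtain ⟨y, rfl⟩ := hy
    exact ⟨x + y, map_add _ x y⟩

end BalancedTensor

/-! ### The map `α` and the finite topology. -/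

section Alpha

variable {R V W : Type*} [Ring R] [AddCommGroup V] [Module R V] [AddCommGroup W]
  [Module Rᵐᵒᵖ W] (κ : V →ₗ[R] RightDual R W) {M N : Type*} [AddCommGroup M] [Module R M]
  [AddCommGroup N] [Module R N]

theorem alphaMap_apply (t : BalancedTensor R W M) (v : V) :
    alphaMap κ M t v = evalLeft (κ v).toLin t := by
  induction t using induction_on with
  | h0 => simp
  | ht w m => rfl
  | ha x y hx hy => rw [map_add, map_add, LinearMap.add_apply, hx, hy]

theorem alphaMap_tmul_apply (w : W) (m : M) (v : V) :
    alphaMap κ M (tmul R w m) v = (κ v).toLin w • m := rfl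

theorem alphaMap_tensorMap (g : M →ₗ[R] N) (t : BalancedTensor R W M) (v : V) :
    alphaMap κ N (tensorMap LinearMap.id g t) v = g (alphaMap κ M t v) := by
  rw [alphaMap_apply, alphaMap_apply, evalLeft_tensorMap_id]

/-- Density means that every `f ∈ W*` agrees with some `κ(v)` on any given finite set. -/
theorem isDensePairing_iff : IsDensePairing κ ↔
    ∀ (f : RightDual R W) (S : Finset W), ∃ v, ∀ w ∈ S, (κ v).toLin w = f.toLin w := by
  let _ : TopologicalSpace R := ⊥
  have : DiscreteTopology R := ⟨rfl⟩
  let _ : TopologicalSpace (RightDual R W) := RightDual.finiteTopology R W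
  have hc : Continuous fun (f : RightDual R W) (w : W) => f.toLin w := continuous_induced_dom
  constructor
  · intro h f S
    have hU : IsOpen {g : RightDual R W | ∀ w ∈ S, g.toLin w = f.toLin w} :=
      (isOpen_set_pi (s := fun w => {f.toLin w}) S.finite_toSet
        fun w _ => isOpen_discrete _).preimage hc
    obtain ⟨_, hx, v, rfl⟩ := Dense.inter_open_nonempty h _ hU ⟨f, fun w _ => rfl⟩
    exact ⟨v, hx⟩
  · intro h f
    refine mem_closure_iff.2 fun U hU hf => ?_
    obtain ⟨O, hO, rfl⟩ := isOpen_induced_iff.1 hU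
    obtain ⟨I, u, hu, hI⟩ := isOpen_pi_iff.1 hO _ hf
    obtain ⟨v, hv⟩ := h f I
    refine ⟨κ v, hI fun w hw => ?_, v, rfl⟩
    change (κ v).toLin w ∈ u w
    rw [hv w hw]
    exact (hu w hw).2

end Alpha

/-! ### α-pairings, density and local projectivity. -/

section AlphaCondition

variable {R V W : Type u} [Ring R] [AddCommGroup V] [Module R V] [AddCommGroup W]
  [Module Rᵐᵒᵖ W] {κ : V →ₗ[R] RightDual R W}

open Classical in
/-- For an α-pairing, `∑ᵢ wᵢ ⊗ eᵢ` vanishes modulo the submodule of the vectors `(⟨v, wᵢ⟩)ᵢ`. -/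
theorem IsRightAlphaPairing.sum_tmul_eq_zero (h : IsRightAlphaPairing κ) (S : Finset W) :
    ∑ w : S, tmul R (w : W) ((LinearMap.range (LinearMap.pi fun w : S =>
      { toFun := fun v => (κ v).toLin (w : W)
        map_add' := fun v v' => by simp
        map_smul' := fun r v => by simp } : V →ₗ[R] S → R)).mkQ
          (Pi.single w 1)) = 0 := by
  -- At `v`, the map `α` gives the class of `∑ ⟨v, w⟩ e_w`, which is the vector attached to `v` and
  -- so lies in the submodule divided out.
  refine h _ ?_
  ext v
  rw [map_zero, map_sum, LinearMap.sum_apply]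
  simp_rw [alphaMap_tmul_apply, ← map_smul]
  rw [← map_sum, LinearMap.zero_apply, Submodule.mkQ_apply, Submodule.Quotient.mk_eq_zero]
  refine ⟨v, ?_⟩
  ext w
  simp [Pi.single_apply]

/-- Applying `f ⊗ id` to the vanishing sum shows that `(f(w))_w` is one of the vectors `(⟨v, w⟩)_w`.
-/
theorem IsRightAlphaPairing.isDensePairing (h : IsRightAlphaPairing κ) : IsDensePairing κ := by
  classical
  refine (isDensePairing_iff κ).2 fun f S => ?_
  have h0 := congrArg (evalLeft f.toLin) (h.sum_tmul_eq_zero S)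
  rw [map_zero, map_sum] at h0
  simp_rw [evalLeft_tmul, ← map_smul] at h0
  rw [← map_sum, Submodule.mkQ_apply, Submodule.Quotient.mk_eq_zero] at h0
  obtain ⟨v, hv⟩ := h0
  refine ⟨v, fun w hw => ?_⟩
  have := congrFun hv ⟨w, hw⟩
  simpa [Pi.single_apply] using this

theorem IsRightAlphaPairing.satisfiesRightAlpha (h : IsRightAlphaPairing κ) :
    SatisfiesRightAlpha R W := by
  refine fun M _ _ => (injective_iff_map_eq_zero _).2 fun t ht =>
    (injective_iff_map_eq_zero _).1 (h M) t ?_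
  ext v
  have := DFunLike.congr_fun ht (κ v)
  rw [alphaMap_apply] at this ⊢
  exact this

/-- A functional `f` sees `t` only through finitely many elements of `W`, and on these it agrees
with some `κ v`. -/
theorem IsDensePairing.isRightAlphaPairing (hd : IsDensePairing κ)
    (h : SatisfiesRightAlpha R W) : IsRightAlphaPairing κ := by
  refine fun M _ _ => (injective_iff_map_eq_zero _).2 fun t ht =>
    (injective_iff_map_eq_zero _).1 (h M) t ?_
  ext f
  obtain ⟨S, hS⟩ := exists_finset_tensorMap_congr R t
  obtain ⟨v, hv⟩ := (isDensePairing_iff κ).1 hd f S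
  have := DFunLike.congr_fun ht v
  rw [alphaMap_apply, evalLeft_eq_tensorMap, hS _ _ hv, ← evalLeft_eq_tensorMap] at this
  rw [alphaMap_apply]
  exact this

/-- With `S` generating `F`, let `E.range` consist of the families `(π (g' w))_w`. The map `d ⊗ x ↦
(g(d) x_w)_w` modulo `E.range` respects the quotient by `K`: if `x = (f(w))_w` and `π l = g d`, then
`w ↦ l f(w)` is a lift. It sends the zero element `∑ w ⊗ e_w` to the class of `(g(w))_w`, so that
family lifts. -/
theorem SatisfiesRightAlpha.isLocallyProjective (h : SatisfiesRightAlpha R W) :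
    IsLocallyProjective Rᵐᵒᵖ W := by
  classical
  rintro L N _ _ _ _ π g F hπ ⟨S, rfl⟩
  have h0 := IsRightAlphaPairing.sum_tmul_eq_zero h S
  set K := LinearMap.range (LinearMap.pi fun w : S =>
      { toFun := fun v => ((LinearMap.id : RightDual R W →ₗ[R] RightDual R W) v).toLin (w : W)
        map_add' := fun v v' => by simp
        map_smul' := fun r v => by simp } : RightDual R W →ₗ[R] S → R)
  let E : (W →ₗ[Rᵐᵒᵖ] L) →+ (S → N) := AddMonoidHom.mk' (fun g' w => π (g' w))
    (fun a b => by ext; simp)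
  let φ (d : W) : ((S → R) ⧸ K) →+ (S → N) ⧸ E.range :=
    QuotientAddGroup.lift _
      (AddMonoidHom.mk' (fun x => QuotientAddGroup.mk' E.range fun w => op (x w) • g d)
        (fun x y => by
          rw [← map_add]
          congr 1
          ext w
          simp [add_smul]))
      (by
        rintro _ ⟨f, rfl⟩
        obtain ⟨l, hl⟩ := hπ (g d)
        refine (QuotientAddGroup.eq_zero_iff _).2
          ⟨{ toFun := fun w => op (f.toLin w) • l
             map_add' := fun w w' => by simp [add_smul]
             map_smul' := fun r w => by simp [mul_smul] }, ?_⟩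
        ext w
        change π (op (f.toLin w) • l) = op (f.toLin w) • g d
        rw [map_smul, hl])
  have hφ (d : W) (x : S → R) : φ d (K.mkQ x) =
      QuotientAddGroup.mk' E.range fun w => op (x w) • g d := rfl
  let ψ : BalancedTensor R W ((S → R) ⧸ K) →+ (S → N) ⧸ E.range :=
    lift (AddMonoidHom.mk' φ (fun d d' => by
        ext y
        obtain ⟨x, rfl⟩ := Submodule.mkQ_surjective _ y
        rw [AddMonoidHom.add_apply, hφ, hφ, hφ, ← map_add]
        congr 1
        ext w
        simp))
      (fun r d y => by
        obtain ⟨x, rfl⟩ := Submodule.mkQ_surjective _ y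
        change φ (op r • d) _ = φ d _
        rw [← map_smul, hφ, hφ]
        congr 1
        ext w
        simp [mul_smul])
  have h1 := congrArg ψ h0
  have hψ (d : W) (x : S → R) : ψ (tmul R d (K.mkQ x)) =
      QuotientAddGroup.mk' E.range fun w => op (x w) • g d := rfl
  rw [map_sum, map_zero] at h1
  simp_rw [hψ] at h1
  rw [← map_sum] at h1
  obtain ⟨g', hg'⟩ := (QuotientAddGroup.eq_zero_iff _).1 h1
  refine ⟨g', fun x hx => ?_⟩
  refine LinearMap.eqOn_span (f := π.comp g') (g := g) (fun w hw => ?_) hx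
  have h2 : π (g' w) = _ := congrFun hg' ⟨w, hw⟩
  refine h2.trans ?_
  simp [Finset.sum_apply, Pi.single_apply, apply_ite op, ite_smul]

/-- Lift the identity of `W`, on the finitely many elements occurring in `t`, through the free cover
`π : R^(W) → W`. The coordinates of the lift `g` lie in `W*`, so `α(t) = 0` forces the image of `t`
in `R^(W) ⊗ M = M^(W)` to vanish, and `π ⊗ id` takes this image back to `t`. -/
theorem IsLocallyProjective.satisfiesRightAlpha (h : IsLocallyProjective Rᵐᵒᵖ W) :
    SatisfiesRightAlpha R W := by
  classical
  refine fun M _ _ => (injective_iff_map_eq_zero _).2 fun t ht => ?_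
  obtain ⟨S, hS⟩ := exists_finset_tensorMap_congr W t
  let π : (W →₀ R) →ₗ[Rᵐᵒᵖ] W :=
    { toFun := fun x => x.sum fun w r => op r • w
      map_add' := fun x y => Finsupp.sum_add_index' (by simp) (by simp [add_smul])
      map_smul' := fun r x => by
        rw [Finsupp.sum_smul_index' (by simp), Finsupp.smul_sum]
        simp [mul_smul] }
  obtain ⟨g, hg⟩ := h (W →₀ R) W π LinearMap.id (Submodule.span _ (S : Set W))
    (fun w => ⟨Finsupp.single w 1, by simp [π]⟩) ⟨S, rfl⟩
  have h1 := hS (π.comp g) LinearMap.id fun x hx => hg x (Submodule.subset_span hx)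
  -- `φ` is the comparison `R^(W) ⊗ M → M^(W)`, and `ψ` is chosen so that `ψ ∘ φ = π ⊗ id`.
  let φ : BalancedTensor R (W →₀ R) M →+ (W →₀ M) :=
    lift (AddMonoidHom.mk' (fun x => AddMonoidHom.mk'
        (fun m => x.mapRange (fun r => r • m) (zero_smul R m))
        (fun m m' => by ext; simp))
      (fun x y => by ext; simp [add_smul]))
      (fun r x m => by ext; simp [mul_smul])
  let ψ : (W →₀ M) →+ BalancedTensor R W M := Finsupp.liftAddHom fun w =>
    AddMonoidHom.mk' (tmul R w) (tmul_add w)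
  have h2 : φ (tensorMap g LinearMap.id t) = 0 := by
    ext w
    have h3 : (φ (tensorMap g LinearMap.id t)) w = evalLeft ((Finsupp.lapply w).comp g) t :=
      DFunLike.congr_fun
        (f := (Finsupp.applyAddHom w).comp (φ.comp (tensorMap g LinearMap.id)))
        (g := evalLeft ((Finsupp.lapply w).comp g)) (hom_ext fun _ _ => rfl) t
    rw [h3]
    exact (alphaMap_apply (LinearMap.id : RightDual R W →ₗ[R] RightDual R W) t _).symm.trans
      (DFunLike.congr_fun ht ((Finsupp.lapply w).comp g : W →ₗ[Rᵐᵒᵖ] R))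
  have hψ (x : W →₀ R) (m : M) : ψ (φ (tmul R x m)) = tmul R (π x) m := by
    induction x using Finsupp.induction_linear with
    | zero => rw [zero_tmul, map_zero, map_zero, map_zero, zero_tmul]
    | add x y hx hy => rw [add_tmul, map_add, map_add, map_add, hx, hy, add_tmul]
    | single w r =>
      simp only [φ, ψ, π, lift_tmul, LinearMap.coe_mk, AddHom.coe_mk, AddMonoidHom.mk'_apply,
        Finsupp.mapRange_single, Finsupp.liftAddHom_apply_single, Finsupp.sum_single_index,
        op_zero, zero_smul, op_smul_tmul]
  have h4 : ψ (φ (tensorMap g LinearMap.id t)) = tensorMap (π.comp g) LinearMap.id t :=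
    DFunLike.congr_fun (f := ψ.comp (φ.comp (tensorMap g LinearMap.id)))
      (g := tensorMap (π.comp g) LinearMap.id) (hom_ext fun c m => hψ (g c) m) t
  rw [h2, map_zero] at h4
  rw [← h4] at h1
  rw [← tensorMap_id_id t, ← h1]

end AlphaCondition

/-! ### Modules over an `R`-ring with unity. -/

namespace LeftRingModule

variable {R A : Type u} [Ring R] [Ring A] [Module R A] [Module Rᵐᵒᵖ A]

/-- Since `a (1 m) = a m` for all `a`, the map `ρ_M` cannot separate `1 m` from `m`. -/
theorem faithful_iff (M : LeftRingModule R A) : faithful M ↔ ∀ m, M.act 1 m = m := by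
  constructor
  · intro h m
    refine h (LinearMap.ext fun a => ?_)
    change M.act a (M.act 1 m) = M.act a m
    rw [← M.mul_act, mul_one]
  · intro h m n hmn
    have h1 : M.act 1 m = M.act 1 n := DFunLike.congr_fun hmn 1
    rwa [h, h] at h1

theorem unital_iff (M : LeftRingModule R A) : unital M ↔ ∀ m, M.act 1 m = m := by
  constructor
  · intro h m
    have hm : m ∈ AddSubgroup.closure {x : M.carrier | ∃ (a : A) (m : M.carrier), x = M.act a m} :=
      h ▸ AddSubgroup.mem_top m
    induction hm using AddSubgroup.closure_induction with
    | mem x hx =>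
      obtain ⟨a, n, rfl⟩ := hx
      rw [← M.mul_act, one_mul]
    | zero => rw [map_zero]
    | add x y _ _ hx hy => rw [map_add, hx, hy]
    | neg x _ hx => rw [map_neg, hx]
  · intro h
    refine eq_top_iff.2 fun m _ => AddSubgroup.subset_closure ⟨1, m, (h m).symm⟩

/-- A submodule of a left `A`-module. -/
def ofSubmodule (L : LeftRingModule R A) (K : Submodule R L.carrier)
    (h : ∀ (a : A), ∀ m ∈ K, L.act a m ∈ K) : LeftRingModule R A where
  carrier := K
  act := AddMonoidHom.mk' (fun a => AddMonoidHom.mk' (fun m => ⟨L.act a m, h a m m.2⟩)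
    (fun m n => by ext; simp)) (fun a b => by ext; simp)
  smul_act r a m := Subtype.ext (L.smul_act r a m)
  op_smul_act r a m := Subtype.ext (L.op_smul_act r a m)
  mul_act a b m := Subtype.ext (L.mul_act a b m)

/-- The inclusion of a submodule. -/
def ofSubmoduleHom (L : LeftRingModule R A) (K : Submodule R L.carrier)
    (h : ∀ (a : A), ∀ m ∈ K, L.act a m ∈ K) : L.ofSubmodule K h ⟶ L :=
  (⟨K.subtype, fun _ _ => rfl⟩ : Hom _ _)

theorem sigma_of_injective {K N L : LeftRingModule R A} (hL : sigma K L) (i : Hom N L)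
    (hi : Function.Injective i.toLin) : sigma K N := by
  obtain ⟨hu, L', hL', j, hj⟩ := hL
  refine ⟨(unital_iff N).2 fun m => hi ?_, L', hL', ⟨j.toLin.comp i.toLin, fun a m => ?_⟩,
    hj.comp hi⟩
  · rw [i.map_act, (unital_iff L).1 hu]
  · rw [LinearMap.comp_apply, i.map_act, j.map_act, LinearMap.comp_apply]

/-- Isomorphism of categories demands equality of objects; once the carriers coincide, only the
actions remain to be compared. -/
theorem mk_eq (N : LeftRingModule R A) (act : A →+ N.carrier →+ N.carrier) (h₁ h₂ h₃)
    (e : act = N.act) : LeftRingModule.mk (R := R) N.carrier act h₁ h₂ h₃ = N := by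
  subst e
  rfl

end LeftRingModule

/-! ### The coaction and cofree comodules. -/

section Comodules

variable {R C : Type u} [Ring R] [AddCommGroup C] [Module R C] [Module Rᵐᵒᵖ C]
  [SMulCommClass R Rᵐᵒᵖ C] [Coring R C]

/-- The action `c ↦ ∑ f(c₁) c₂` of `f ∈ C*` on `C`. -/
def RightDual.hit (f : RightDual R C) : C →ₗ[Rᵐᵒᵖ] C where
  toFun c := evalLeft f.toLin (Coring.comul (R := R) c)
  map_add' c d := by simp
  map_smul' r c := by
    have h : ∀ t : BalancedTensor R C C,
        evalLeft f.toLin (r • t) = r • evalLeft f.toLin t := fun t => by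
      induction t using induction_on with
      | h0 => simp
      | ht c d => simp [smul_tmul_right, smul_comm]
      | ha x y hx hy => simp [hx, hy]
    exact (congrArg _ (Coring.comul_op_smul (unop r) c)).trans (h _)

theorem RightDual.hit_one : (1 : RightDual R C).hit = LinearMap.id :=
  LinearMap.ext fun c => Coring.counit_comul c

variable {M : Type u} [AddCommGroup M] [Module R M]

theorem evalLeft_mul (f g : RightDual R C) (t : BalancedTensor R C M) :
    evalLeft (f * g).toLin t = evalLeft f.toLin (tensorMap g.hit LinearMap.id t) := by
  induction t using induction_on with
  | h0 => simp only [map_zero]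
  | ht c m => rfl
  | ha x y hx hy => simp only [map_add, hx, hy]

/-- Contracting the first leg of `Δ ⊗ id` with `f` leaves `f` acting on `C`. This computes the
action on `C ⊗ M` and the coaction of `f · m`. -/
theorem evalLeft_assoc_comul (f : RightDual R C) (t : BalancedTensor R C M) :
    evalLeft f.toLin (assoc R C C M (tensorMap (Coring.comulRight R C) LinearMap.id t)) =
      tensorMap f.hit LinearMap.id t := by
  induction t using induction_on with
  | h0 => simp only [map_zero]
  | ht c m => exact evalLeft_assoc f.toLin _ m
  | ha x y hx hy => simp only [map_add, hx, hy]

variable (R C) in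
/-- `s ↦ ∑ s₁ ⊗ (s₂ ⊗ m)` on `C ⊗ C`, as a left `R`-linear map. -/
def assocRight (m : M) :
    BalancedTensor R C C →ₗ[R] BalancedTensor R C (BalancedTensor R C M) where
  toFun s := assoc R C C M (tmul R s m)
  map_add' s t := by rw [add_tmul, map_add]
  map_smul' r s := by
    rw [RingHom.id_apply]
    induction s using induction_on with
    | h0 => simp only [smul_zero, zero_tmul, map_zero]
    | ht c d => rfl
    | ha x y hx hy => simp only [smul_add, add_tmul, map_add, hx, hy]

variable (R C M) in
/-- The map `c ⊗ m ↦ ∑ c₁ ⊗ (c₂ ⊗ m)`. -/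
def cofreeCoact : BalancedTensor R C M →ₗ[R] BalancedTensor R C (BalancedTensor R C M) where
  toFun t := assoc R C C M (tensorMap (Coring.comulRight R C) LinearMap.id t)
  map_add' s t := by rw [map_add, map_add]
  map_smul' r t := by
    rw [RingHom.id_apply]
    induction t using induction_on with
    | h0 => simp only [smul_zero, map_zero]
    | ht c m =>
      exact (congrArg (assocRight R C m) (map_smul (Coring.comul (R := R)) r c)).trans
        (map_smul (assocRight R C m) r _)
    | ha x y hx hy => simp only [smul_add, map_add, hx, hy]

/-- This is coassociativity of `C` with a passive factor `m`: both sides on `c ⊗ m` are `assocRight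
R C m` applied in the second leg to the two iterated comultiplications of `c`. -/
theorem cofreeCoact_coassoc (t : BalancedTensor R C M) :
    tensorMap LinearMap.id (cofreeCoact R C M) (cofreeCoact R C M t) =
      assoc R C C _ (tensorMap (Coring.comulRight R C) LinearMap.id (cofreeCoact R C M t)) := by
  have h1 (m : M) (s : BalancedTensor R C C) :
      tensorMap LinearMap.id (cofreeCoact R C M) (assocRight R C m s) =
        tensorMap LinearMap.id (assocRight R C m)
          (tensorMap LinearMap.id (Coring.comul (R := R)) s) := by
    induction s using induction_on with
    | h0 => simp only [map_zero]
    | ht c d => rfl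
    | ha x y hx hy => simp only [map_add, hx, hy]
  have h2 (m : M) (d : C) (s : BalancedTensor R C C) :
      assoc R C C _ (tmul R s (tmul R d m)) =
        tensorMap LinearMap.id (assocRight R C m) (assoc R C C C (tmul R s d)) := by
    induction s using induction_on with
    | h0 => simp only [zero_tmul, map_zero]
    | ht c d => rfl
    | ha x y hx hy => simp only [add_tmul, map_add, hx, hy]
  have h3 (m : M) (s : BalancedTensor R C C) :
      assoc R C C _ (tensorMap (Coring.comulRight R C) LinearMap.id (assocRight R C m s)) =
        tensorMap LinearMap.id (assocRight R C m)
          (assoc R C C C (tensorMap (Coring.comulRight R C) LinearMap.id s)) := by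
    induction s using induction_on with
    | h0 => simp only [map_zero]
    | ht c d => exact h2 m d _
    | ha x y hx hy => simp only [map_add, hx, hy]
  induction t using induction_on with
  | h0 => simp only [map_zero]
  | ht c m =>
    refine (h1 m (Coring.comul (R := R) c)).trans (Eq.trans ?_ (h3 m (Coring.comul c)).symm)
    exact congrArg _ (Coring.coassoc c)
  | ha x y hx hy => simp only [map_add, hx, hy]

variable (R C M) in
/-- The comodule `C ⊗_R M` cofreely generated by a left `R`-module `M`. -/
def LeftComodule.cofree : LeftComodule R C where
  carrier := BalancedTensor R C M
  coact := cofreeCoact R C M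
  coassoc := cofreeCoact_coassoc
  counital := Function.LeftInverse.injective (g := evalLeft (1 : RightDual R C).toLin) fun t => by
    refine (evalLeft_assoc_comul 1 t).trans ?_
    rw [RightDual.hit_one, tensorMap_id_id]

variable (R C M) in
/-- `ε ⊗ id : C ⊗_R M → M`. -/
def counitLeft : BalancedTensor R C M →ₗ[R] M where
  toFun := evalLeft (1 : RightDual R C).toLin
  map_add' := map_add _
  map_smul' r t := by
    rw [RingHom.id_apply]
    induction t using induction_on with
    | h0 => simp only [smul_zero, map_zero]
    | ht c m =>
      exact (congrArg (· • m) (map_smul (Coring.counit (R := R)) r c)).trans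
        (mul_smul r (Coring.counit (R := R) c) m)
    | ha x y hx hy => simp only [smul_add, map_add, hx, hy]

theorem tensorMap_counitLeft_cofreeCoact (t : BalancedTensor R C M) :
    tensorMap LinearMap.id (counitLeft R C M) (cofreeCoact R C M t) = t := by
  have h (m : M) (s : BalancedTensor R C C) :
      tensorMap LinearMap.id (counitLeft R C M) (assocRight R C m s) =
        tmul R (evalRight (Coring.counit (R := R)) s) m := by
    induction s using induction_on with
    | h0 => simp only [map_zero, zero_tmul]
    | ht c d => exact (op_smul_tmul (Coring.counit (R := R) d) c m).symm
    | ha x y hx hy => simp only [map_add, add_tmul, hx, hy]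
  induction t using induction_on with
  | h0 => simp only [map_zero]
  | ht c m => exact (h m _).trans (congrArg (fun d => tmul R d m) (Coring.comul_counit c))
  | ha x y hx hy => simp only [map_add, hx, hy]

namespace LeftComodule

/-- A colinear map into a cofree comodule is determined by its composite with `ε ⊗ id`. -/
theorem Hom.eq_zero_of_counitLeft {X : LeftComodule R C} (j : Hom X (cofree R C M))
    (h : ∀ x, counitLeft R C M (j.toLin x) = 0) (x : X.carrier) : j.toLin x = 0 := by
  -- Writing `δ` for the cofree coaction, `j = (id ⊗ (ε ⊗ id)) δ j = (id ⊗ (ε ⊗ id) j) ϱ_X`, by the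
  -- counit law and colinearity.
  refine (tensorMap_counitLeft_cofreeCoact _).symm.trans ?_
  refine (congrArg (tensorMap LinearMap.id (counitLeft R C M)) (j.colinear x)).trans ?_
  exact tensorMap_tensorMap_eq_zero (N' := BalancedTensor R C M) j.toLin _ h _

/-- The coaction as a colinear map into a cofree comodule. -/
def coactHom (X : LeftComodule R C) : X ⟶ cofree R C X.carrier :=
  (⟨X.coact, fun m => (X.coassoc m).symm⟩ : Hom _ _)

theorem coact_evalLeft (X : LeftComodule R C) (f : RightDual R C) (m : X.carrier) :
    X.coact (evalLeft f.toLin (X.coact m)) = tensorMap f.hit LinearMap.id (X.coact m) := by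
  rw [← evalLeft_tensorMap_id, X.coassoc, evalLeft_assoc_comul]

end LeftComodule

/-! ### The canonical functor, rational modules and `σ[C]`. -/

namespace MeasuringRightPairing

open LeftRingModule

variable {A : Type u} [Ring A] [Module R A] [Module Rᵐᵒᵖ A] (P : MeasuringRightPairing R A C)

theorem kappa_one : P.kappa 1 = 1 := map_one P.ringHom

theorem kappa_mul (a b : A) : P.kappa (a * b) = P.kappa a * P.kappa b := map_mul P.ringHom a b

theorem functor_act (X : LeftComodule R C) (a : A) (m : X.carrier) :
    (P.functor.obj X).act a m = evalLeft (P.kappa a).toLin (X.coact m) :=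
  alphaMap_apply P.kappa _ a

/-- The elements `1 m` and `m` have the same coaction, so injectivity of the coaction yields the
usual counit law. -/
theorem functor_one_act (X : LeftComodule R C) (m : X.carrier) :
    (P.functor.obj X).act 1 m = m := by
  rw [functor_act, kappa_one]
  apply X.counital
  rw [X.coact_evalLeft, RightDual.hit_one, tensorMap_id_id]

theorem selfModule_act (a : A) (c : C) :
    P.selfModule.act a c = (P.kappa a).hit c :=
  P.functor_act (LeftComodule.self R C) a c

theorem selfModule_directSum_act_single {Λ : Type u} (a : A) (l : Λ) (c : C) :
    (P.selfModule.directSum Λ).act a (Finsupp.single l c : Λ →₀ C) =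
      (Finsupp.single l ((P.kappa a).hit c) : Λ →₀ C) :=
  (Finsupp.mapRange_single (hf := map_zero (P.selfModule.act a))).trans
    (congrArg (Finsupp.single l) (P.selfModule_act a c))

theorem cofree_act (a : A) (t : BalancedTensor R C M) :
    (P.functor.obj (LeftComodule.cofree R C M)).act a t =
      tensorMap (P.kappa a).hit LinearMap.id t :=
  (P.functor_act (LeftComodule.cofree R C M) a t).trans (evalLeft_assoc_comul _ t)

theorem alphaMap_smul (r : R) (t : BalancedTensor R C M) (a : A) :
    alphaMap P.kappa M (r • t) a = alphaMap P.kappa M t (op r • a) := by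
  induction t using induction_on with
  | h0 => simp
  | ht c m =>
    change (P.ringHom a).toLin (r • c) • m = (P.ringHom (op r • a)).toLin c • m
    rw [P.map_op_smul, RightDual.op_smul_toLin]
  | ha x y hx hy => rw [smul_add, map_add, map_add, LinearMap.add_apply,
      LinearMap.add_apply, hx, hy]

theorem alphaMap_one (t : BalancedTensor R C M) :
    alphaMap P.kappa M t 1 = counitLeft R C M t := by
  rw [alphaMap_apply, kappa_one]
  rfl

/-- Makes the kernel of `α_M` stable under `A`, and reduces coassociativity to associativity of the
action. -/
theorem alphaMap_hit (a b : A) (t : BalancedTensor R C M) :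
    alphaMap P.kappa M (tensorMap (P.kappa b).hit LinearMap.id t) a =
      alphaMap P.kappa M t (a * b) := by
  rw [alphaMap_apply, alphaMap_apply, kappa_mul, evalLeft_mul]

/-- The map `C^(M) → C ⊗_R M` as a morphism of left `A`-modules. -/
def cofreeGenerators (M : Type u) [AddCommGroup M] [Module R M] :
    LeftRingModule.Hom (P.selfModule.directSum M) (P.functor.obj (LeftComodule.cofree R C M)) where
  toLin := ofFinsupp R C M
  map_act a x := by
    refine DFunLike.congr_fun
      (f := (ofFinsupp R C M).toAddMonoidHom.comp ((P.selfModule.directSum M).act a))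
      (g := ((P.functor.obj (LeftComodule.cofree R C M)).act a).comp
        (ofFinsupp R C M).toAddMonoidHom)
      (Finsupp.addHom_ext fun m c => ?_) x
    refine (congrArg (ofFinsupp R C M) (P.selfModule_directSum_act_single a m c)).trans
      ((ofFinsupp_single (R := R) (M := C) _ m).trans ?_)
    refine Eq.trans ?_ (P.cofree_act a _).symm
    exact (congrArg (tensorMap (P.kappa a).hit LinearMap.id)
      (ofFinsupp_single (R := R) (M := C) c m)).symm

/-- The coaction embeds `X` into the cofree comodule `C ⊗ X`, which is a quotient of `C^(X)`. -/
theorem sigma_functor_obj (X : LeftComodule R C) : sigma P.selfModule (P.functor.obj X) :=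
  ⟨(unital_iff _).2 (P.functor_one_act X), _,
    ⟨_, P.cofreeGenerators X.carrier, ofFinsupp_surjective⟩,
    P.functor.map X.coactHom, X.counital⟩

theorem isRational_functor_obj (X : LeftComodule R C) : P.IsRational (P.functor.obj X) :=
  fun m => ⟨X.coact m, rfl⟩

/-- If the canonical functor is an isomorphism onto `σ[_A C]`, the pairing is an α-pairing. -/
theorem isRightAlphaPairing_of_isIsomorphismOnto
    (h : IsIsomorphismOnto P.functor (sigma P.selfModule)) : IsRightAlphaPairing P.kappa := by
  obtain ⟨hfull, -, -, hobj⟩ := h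
  intro M _ _
  -- Surjectivity onto the objects of `σ[C]` and fullness turn any `A`-linear map from such a module
  -- to `C ⊗ M` into a colinear one.
  have key (N : LeftRingModule R A) (hN : sigma P.selfModule N)
      (i : N ⟶ P.functor.obj (LeftComodule.cofree R C M))
      (hi : ∀ x, counitLeft R C M (LeftRingModule.Hom.toLin i x) = 0) (x : N.carrier) :
      LeftRingModule.Hom.toLin i x = 0 := by
    obtain ⟨X, rfl⟩ := (hobj N).1 hN
    obtain ⟨j, rfl⟩ := P.functor.map_surjective i
    exact LeftComodule.Hom.eq_zero_of_counitLeft j hi x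
  let L := P.functor.obj (LeftComodule.cofree R C M)
  let K : Submodule R L.carrier :=
    { carrier := {t | alphaMap P.kappa M t = 0}
      add_mem' := fun {s t} (hs : alphaMap P.kappa M s = 0) (ht : alphaMap P.kappa M t = 0) =>
        (map_add (alphaMap P.kappa M) s t).trans ((congrArg₂ (· + ·) hs ht).trans (add_zero 0))
      zero_mem' := map_zero (alphaMap P.kappa M)
      smul_mem' := fun r t (ht : alphaMap P.kappa M t = 0) => LinearMap.ext fun a =>
        (P.alphaMap_smul r t a).trans (DFunLike.congr_fun ht _) }
  have hK (a : A) (t) (ht : t ∈ K) : L.act a t ∈ K := LinearMap.ext fun b => by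
    exact (congrArg (fun t => alphaMap P.kappa M t b) (P.cofree_act a t)).trans
      ((P.alphaMap_hit b a t).trans (DFunLike.congr_fun (f := alphaMap P.kappa M t) ht _))
  refine (injective_iff_map_eq_zero _).2 fun t ht => ?_
  refine key (L.ofSubmodule K hK) (sigma_of_injective (P.sigma_functor_obj _)
    (L.ofSubmoduleHom K hK) Subtype.val_injective) (L.ofSubmoduleHom K hK) (fun x => ?_) ⟨t, ht⟩
  exact (P.alphaMap_one x.1).symm.trans (DFunLike.congr_fun (f := alphaMap P.kappa M x.1) x.2 1)

theorem ratFaithful_eq_ratUnital : P.ratFaithful = P.ratUnital := by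
  ext M
  exact and_congr_left fun _ => (faithful_iff M).trans (unital_iff M).symm

variable {P}

/-- Over an α-pairing, submodules of rational modules are rational. -/
theorem IsRational.of_injective (hP : IsRightAlphaPairing P.kappa) {N L : LeftRingModule R A}
    (hL : P.IsRational L) (i : LeftRingModule.Hom N L) (hi : Function.Injective i.toLin) :
    P.IsRational N := by
  intro n
  obtain ⟨t, ht⟩ := hL (i.toLin n)
  -- In `C ⊗ L/i(N)` the image of `t` is killed by `α`, because `a i(n) = i(a n)`. Hence it is zero,
  -- and `t` comes from `C ⊗ N` by right exactness.
  obtain ⟨s, rfl⟩ := mem_range_of_tensorMap_mkQ_eq_zero i.toLin t (by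
    refine (injective_iff_map_eq_zero _).1 (hP _) _ (LinearMap.ext fun a => ?_)
    rw [alphaMap_tensorMap, ht]
    refine (Submodule.Quotient.mk_eq_zero _).2 ⟨N.act a n, i.map_act a n⟩)
  refine ⟨s, LinearMap.ext fun a => hi ?_⟩
  rw [← alphaMap_tensorMap, ht]
  exact (i.map_act a n).symm

/-- For `c` in the summand `l`, the tensor `(id ⊗ p_l) Δ(c)` represents `a ↦ a p_l(c)`; sums of such
tensors handle the rest. -/
theorem isRational_of_isGenerated {L : LeftRingModule R A} (h : IsGenerated P.selfModule L) :
    P.IsRational L := by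
  obtain ⟨Λ, p, hp⟩ := h
  let p' : (Λ →₀ C) →ₗ[R] L.carrier := p.toLin
  have hp' (x : Λ →₀ C) : ∃ t, ∀ a, alphaMap P.kappa L.carrier t a = L.act a (p' x) := by
    induction x using Finsupp.induction_linear with
    | zero => exact ⟨0, fun a => by simp only [map_zero, LinearMap.zero_apply]⟩
    | add x y hx hy =>
      obtain ⟨s, hs⟩ := hx
      obtain ⟨t, ht⟩ := hy
      exact ⟨s + t, fun a => by simp only [map_add, LinearMap.add_apply, hs, ht]⟩
    | single l c =>
      refine ⟨tensorMap LinearMap.id (p'.comp (Finsupp.lsingle l)) (Coring.comul (R := R) c),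
        fun a => ?_⟩
      rw [alphaMap_tensorMap, alphaMap_apply]
      refine Eq.trans ?_ (p.map_act a (Finsupp.single l c : Λ →₀ C))
      exact congrArg p' (P.selfModule_directSum_act_single a l c).symm
  intro l
  obtain ⟨x, rfl⟩ := hp l
  obtain ⟨t, ht⟩ := hp' x
  exact ⟨t, LinearMap.ext ht⟩

theorem ratUnital_eq_sigma (hP : IsRightAlphaPairing P.kappa)
    (h : IsIsomorphismOnto P.functor P.ratFaithful) :
    P.ratUnital = sigma P.selfModule := by
  ext N
  constructor
  · rw [← P.ratFaithful_eq_ratUnital]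
    intro hN
    obtain ⟨X, rfl⟩ := (h.2.2.2 N).1 hN
    exact P.sigma_functor_obj X
  · rintro ⟨hu, L, hL, i, hi⟩
    exact ⟨hu, (isRational_of_isGenerated hL).of_injective hP i hi⟩

/-- The comodule structure on a faithful rational module over an α-pairing. -/
theorem exists_functor_obj_eq (hP : IsRightAlphaPairing P.kappa) (N : LeftRingModule R A)
    (hN : P.ratFaithful N) : ∃ X, P.functor.obj X = N := by
  obtain ⟨hf, hr⟩ := hN
  choose ϱ hϱ using hr
  have hϱ' (m : N.carrier) (a : A) : alphaMap P.kappa _ (ϱ m) a = N.act a m := by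
    rw [hϱ]; rfl
  have hev (m : N.carrier) (a : A) : evalLeft (P.kappa a).toLin (ϱ m) = N.act a m := by
    rw [← hϱ' m a, alphaMap_apply]
  let coact : N.carrier →ₗ[R] BalancedTensor R C N.carrier :=
    { toFun := ϱ
      map_add' := fun m n => hP _ <| LinearMap.ext fun a => by
        rw [map_add, LinearMap.add_apply, hϱ', hϱ', hϱ', map_add]
      map_smul' := fun r m => hP _ <| LinearMap.ext fun a => by
        rw [RingHom.id_apply, hϱ', P.alphaMap_smul, hϱ', N.op_smul_act] }
  refine ⟨{ carrier := N.carrier, coact := coact, coassoc := fun m => ?_,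
            counital := fun m n hmn => hf ?_ }, mk_eq N _ _ _ _ ?_⟩
  -- Applying `α` twice tests elements of `C ⊗ (C ⊗ N)`; the two sides become `b (a m)` and `(b a)
  -- m`.
  · refine hP _ (LinearMap.ext fun a => hP _ (LinearMap.ext fun b => ?_))
    rw [alphaMap_apply P.kappa (M := BalancedTensor R C N.carrier),
      alphaMap_apply P.kappa (M := BalancedTensor R C N.carrier), evalLeft_tensorMap_id,
      evalLeft_assoc_comul, P.alphaMap_hit]
    change alphaMap P.kappa _ (ϱ (evalLeft _ (ϱ m))) b = alphaMap P.kappa _ (ϱ m) (b * a)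
    rw [hϱ', hϱ', hev, N.mul_act]
  · rw [← hϱ, ← hϱ]
    exact congrArg _ hmn
  · ext a m
    exact hϱ' m a

/-- The action determines `α(ϱ(m))`, hence `ϱ(m)`. -/
theorem functor_obj_injective (hP : IsRightAlphaPairing P.kappa) :
    Function.Injective P.functor.obj := by
  rintro ⟨M, ϱ, h₁, h₂⟩ ⟨N, ϱ', h₁', h₂'⟩ h
  obtain ⟨e₁, e₂, e₃, e₄⟩ := LeftRingModule.mk.inj h
  subst e₁
  cases e₂
  cases e₃
  have e : ϱ = ϱ' := by
    ext m
    refine hP _ (LinearMap.ext fun a => ?_)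
    exact DFunLike.congr_fun (DFunLike.congr_fun (eq_of_heq e₄) a) m
  subst e
  rfl

/-- For fullness, `α` turns the colinearity equation into `A`-linearity of `g`. -/
theorem isIsomorphismOnto_ratFaithful (hP : IsRightAlphaPairing P.kappa) :
    IsIsomorphismOnto P.functor P.ratFaithful := by
  refine ⟨⟨fun {X Y} g => ⟨⟨LeftRingModule.Hom.toLin g, fun m => ?_⟩, rfl⟩⟩,
    ⟨fun {X Y} f g h => ?_⟩, functor_obj_injective hP, fun N =>
    ⟨exists_functor_obj_eq hP N, ?_⟩⟩
  · refine hP _ (LinearMap.ext fun a => ?_)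
    exact (LeftRingModule.Hom.map_act g a m).symm.trans
      (alphaMap_tensorMap P.kappa (M := X.carrier) (N := Y.carrier) g.toLin (X.coact m) a).symm
  · exact LeftComodule.Hom.ext (congrArg LeftRingModule.Hom.toLin h)
  · rintro ⟨X, rfl⟩
    exact ⟨(faithful_iff _).2 (P.functor_one_act X), P.isRational_functor_obj X⟩

end MeasuringRightPairing
end Comodules

end

theorem mainTheorem2 {R A C : Type u} [Ring R] [Nontrivial R]
    [Ring A] [Module R A] [Module Rᵐᵒᵖ A] [RRing R A]
    [AddCommGroup C] [Module R C] [Module Rᵐᵒᵖ C] [SMulCommClass R Rᵐᵒᵖ C] [Coring R C]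
    (P : MeasuringRightPairing R A C) :
    List.TFAE
      [IsLocallyProjective Rᵐᵒᵖ C ∧ IsDensePairing P.kappa,
       SatisfiesRightAlpha R C ∧ IsDensePairing P.kappa,
       IsRightAlphaPairing P.kappa,
       IsIsomorphismOnto (MeasuringRightPairing.dual R C).functor
           (LeftRingModule.sigma (MeasuringRightPairing.dual R C).selfModule) ∧
         IsIsomorphismOnto P.functor (LeftRingModule.sigma P.selfModule)] ∧
    (IsRightAlphaPairing P.kappa →
      (IsIsomorphismOnto P.functor P.ratFaithful ∧
        P.ratFaithful = P.ratUnital ∧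
        P.ratUnital = LeftRingModule.sigma P.selfModule) ∧
      (IsIsomorphismOnto (MeasuringRightPairing.dual R C).functor
          (MeasuringRightPairing.dual R C).ratFaithful ∧
        (MeasuringRightPairing.dual R C).ratFaithful =
          (MeasuringRightPairing.dual R C).ratUnital ∧
        (MeasuringRightPairing.dual R C).ratUnital =
          LeftRingModule.sigma (MeasuringRightPairing.dual R C).selfModule)) := by
  have core {B : Type u} [Ring B] [Module R B] [Module Rᵐᵒᵖ B] (Q : MeasuringRightPairing R B C)
      (hQ : IsRightAlphaPairing Q.kappa) :
      IsIsomorphismOnto Q.functor Q.ratFaithful ∧ Q.ratFaithful = Q.ratUnital ∧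
        Q.ratUnital = LeftRingModule.sigma Q.selfModule :=
    have h := MeasuringRightPairing.isIsomorphismOnto_ratFaithful hQ
    ⟨h, Q.ratFaithful_eq_ratUnital, MeasuringRightPairing.ratUnital_eq_sigma hQ h⟩
  -- The α-condition on `C` is by definition the statement that `(C*, C)` is an α-pairing, so `core`
  -- applies to it as well.
  have all (hP : IsRightAlphaPairing P.kappa) :=
    And.intro (core P hP) (core (MeasuringRightPairing.dual R C) hP.satisfiesRightAlpha)
  refine ⟨?_, all⟩
  tfae_have 1 → 2 := fun h => ⟨h.1.satisfiesRightAlpha, h.2⟩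
  tfae_have 2 → 1 := fun h => ⟨h.1.isLocallyProjective, h.2⟩
  tfae_have 2 → 3 := fun h => h.2.isRightAlphaPairing h.1
  tfae_have 3 → 2 := fun h => ⟨h.satisfiesRightAlpha, h.isDensePairing⟩
  tfae_have 3 → 4 := fun h => by
    obtain ⟨⟨h₁, h₂, h₃⟩, h₁', h₂', h₃'⟩ := all h
    rw [h₂, h₃] at h₁
    rw [h₂', h₃'] at h₁'
    exact ⟨h₁', h₁⟩
  tfae_have 4 → 3 := fun h => P.isRightAlphaPairing_of_isIsomorphismOnto h.2
  tfae_finish
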